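/- Let $\mathcal A=\{H_1,\dots,H_n\}$ be a central arrangement of $n$ distinct hyperplanes in $V=\mathbb C^\ell$, where $H_i$ is the kernel of the nonzero linear form $f_i=\sum_{j=1}^{\ell} c_{ij}x_j$. Put $R=\mathbb C[x_1,\dots,x_\ell]$, $S=\mathbb C[x_1,\dots,x_\ell,a_1,\dots,a_n]$, $Q=\prod_{i=1}^n f_i$ and $M=V\setminus\bigcup_i H_i$. Let $$\operatorname{Der}(\mathcal A)=\{\theta\in\operatorname{Der}_{\mathbb C}(R):\theta(Q)\in (Q)\},\qquad \omega_{\mathbf a}=\sum_{i=1}^n a_i\,\frac{df_i}{f_i}=\sum_{j=1}^{\ell}\Big(\sum_{i=1}^n \frac{a_ic_{ij}}{f_i}\Big)dx_j .$$ For $\theta\in\operatorname{Der}(\mathcal A)$ the pairing $\langle\theta,\omega_{\mathbf a}\rangle=\sum_{j}\theta(x_j)\sum_i a_ic_{ij}/f_i$ lies in $S$; let $I=I(\mathcal A)\subseteq S$ be the ideal generated by all $\langle\theta,\omega_{\mathbf a}\rangle$, $\theta\in \operatorname{Der}(\mathcal A)$ (the logarithmic ideal), and let $$\Sigma=\Sigma(\mathcal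 A)=\Big\{(x,\lambda)\in M\times\mathbb C^n:\ \sum_{i=1}^n\frac{\lambda_ic_{ij}}{f_i(x)}=0\ \text{ for } 1\le j\le \ell\Big\}$$ be the universal critical variety. Then the zero set $V(I)\subseteq V\times\mathbb C^n$ of $I$ is equal to the closure $\overline\Sigma$ of $\Sigma$ in $V\times\mathbb C^n$ (for the usual complex topology). If moreover $\mathcal A$ has rank $\ell$, i.e. contains $\ell$ linearly independent hyperplanes, then $\overline\Sigma$ is an irreducible algebraic variety of codimension $\ell$ in $V\times\mathbb C^n$. -/

import Mathlib

open MvPolynomial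

/-- A central arrangement of `n` (distinct) hyperplanes in `V = ℂ^ℓ`.  The `i`-th hyperplane is the
kernel of the nonzero linear form `f_i = ∑ j, c i j * x_j`. -/
structure CentralArrangement (ℓ n : ℕ) where
  /-- The coefficient matrix of the linear forms. -/
  c : Matrix (Fin n) (Fin ℓ) ℂ
  ne_zero : ∀ i, c i ≠ 0
  distinct : Function.Injective fun i => {x : Fin ℓ → ℂ | ∑ j, c i j * x j = 0}

namespace CentralArrangement

/-- The coordinate ring `S = ℂ[x_1, …, x_ℓ, a_1, …, a_n]` of `V × ℂ^n`; the variable `x_j` is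
`X (Sum.inl j)` and the variable `a_i` is `X (Sum.inr i)`.  Accordingly a point `(x, lam)` of
`V × ℂ^n` is a function `p : Fin ℓ ⊕ Fin n → ℂ` with `x j = p (Sum.inl j)` and
`lam i = p (Sum.inr i)`; such functions carry the usual (product) topology. -/
abbrev CoordRing (ℓ n : ℕ) : Type := MvPolynomial (Fin ℓ ⊕ Fin n) ℂ

variable {ℓ n : ℕ} (A : CentralArrangement ℓ n)

/-- The rank of the arrangement: the maximal number of linearly independent hyperplanes. -/
noncomputable def rank : ℕ := A.c.rank

/-- The linear form `f_i`, as an element of `R = ℂ[x_1, …, x_ℓ]`. -/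
noncomputable def form (i : Fin n) : MvPolynomial (Fin ℓ) ℂ := ∑ j, C (A.c i j) * X j

/-- The defining polynomial `Q = f_1 ⋯ f_n`. -/
noncomputable def definingPoly : MvPolynomial (Fin ℓ) ℂ := ∏ i, A.form i

/-- The complement `M` of the union of the hyperplanes. -/
def complement : Set (Fin ℓ → ℂ) := {x | ∀ i, eval x (A.form i) ≠ 0}

/-- The module `Der(A)` of logarithmic derivations: the derivations `θ` of `R` with
`θ(Q) ∈ (Q)`. -/
noncomputable def logDer :
    Submodule (MvPolynomial (Fin ℓ) ℂ)
      (Derivation ℂ (MvPolynomial (Fin ℓ) ℂ) (MvPolynomial (Fin ℓ) ℂ)) where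
  carrier := {θ | θ A.definingPoly ∈ Ideal.span {A.definingPoly}}
  zero_mem' := by simp
  add_mem' {θ η} hθ hη := by
    simpa using Ideal.add_mem _ hθ hη
  smul_mem' r θ hθ := by
    simpa using Ideal.mul_mem_left _ r hθ

/-- The coefficient `d_j = ∑ i, a_i c_{ij} / f_i` of `dx_j` in the universal one-form
`ω_a = ∑ i, a_i df_i / f_i`, as a rational function on `V × ℂ^n`. -/
noncomputable def omegaCoeff (j : Fin ℓ) : FractionRing (CoordRing ℓ n) :=
  ∑ i, algebraMap (CoordRing ℓ n) (FractionRing (CoordRing ℓ n)) (X (Sum.inr i) * C (A.c i j)) /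
    algebraMap (CoordRing ℓ n) (FractionRing (CoordRing ℓ n)) (rename Sum.inl (A.form i))

/-- The duality pairing `⟨θ, ω_a⟩ = ∑ j, θ(x_j) d_j` of a derivation `θ` with `ω_a`. -/
noncomputable def pairing
    (θ : Derivation ℂ (MvPolynomial (Fin ℓ) ℂ) (MvPolynomial (Fin ℓ) ℂ)) :
    FractionRing (CoordRing ℓ n) :=
  ∑ j, algebraMap (CoordRing ℓ n) (FractionRing (CoordRing ℓ n)) (rename Sum.inl (θ (X j))) *
    A.omegaCoeff j

/-- The logarithmic ideal `I = ⟨Der(A), ω_a⟩` of `S`, generated by the pairings of `ω_a` with the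
logarithmic derivations (each of these rational functions is a polynomial). -/
noncomputable def logIdeal : Ideal (CoordRing ℓ n) :=
  Ideal.span {s | ∃ θ ∈ A.logDer,
    algebraMap (CoordRing ℓ n) (FractionRing (CoordRing ℓ n)) s = A.pairing θ}

/-- The universal critical variety
`Σ(A) = {(x, lam) ∈ M × ℂ^n : ω_lam(x) = 0}`, where
`ω_lam = ∑ i, lam_i df_i / f_i = ∑ j, (∑ i, lam_i c_{ij} / f_i) dx_j`. -/
def criticalVariety : Set (Fin ℓ ⊕ Fin n → ℂ) :=
  {p | (fun j => p (Sum.inl j)) ∈ A.complement ∧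
    ∀ j, ∑ i, p (Sum.inr i) * A.c i j / eval (fun k => p (Sum.inl k)) (A.form i) = 0}

end CentralArrangement

/-- `Z` is an irreducible algebraic subset of affine space: it is Zariski closed, nonempty, and not
the union of two proper Zariski closed subsets. -/
def IsIrreducibleVariety {σ : Type} (Z : Set (σ → ℂ)) : Prop :=
  (∃ J : Ideal (MvPolynomial σ ℂ), Z = zeroLocus ℂ J) ∧ Z.Nonempty ∧
    ∀ J K : Ideal (MvPolynomial σ ℂ), Z ⊆ zeroLocus ℂ J ∪ zeroLocus ℂ K →
      Z ⊆ zeroLocus ℂ J ∨ Z ⊆ zeroLocus ℂ K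

/-- The codimension of an algebraic subset `Z` of affine space: the height of its vanishing
ideal. -/
noncomputable def varietyCodim {σ : Type} (Z : Set (σ → ℂ)) : ℕ∞ :=
  (vanishingIdeal ℂ Z).height

/-!
Let `Σ` be the critical variety and `I` the logarithmic ideal. At a point `(x, lam)` with `x` off
the hyperplanes the pairings with derivations take the expected values, so `Σ`, and hence its
closure, lies in the zero set of `I`.

Conversely let `(x, lam)` be a zero of `I`, let `E` be the set of hyperplanes through `x`, and let
`U ⊆ ℂ^E` be the space of the vectors `(f_i(y))`, `y ∈ ℂ^ℓ`. Suitable logarithmic derivations show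
two things. Derivations that are constant along the flat of `x` show that the part of the
universal form coming from the hyperplanes not through `x` is at `x` a combination of the `f_i`,
`i ∈ E` (`sum_flat_eq_zero`). Derivations that are linear near `x` show that `(lam_i)`, `i ∈ E`,
is orthogonal to the diagonal stabilizer of `U`, the vectors `t` with `t * U ⊆ U`
(`mem_dotPerp_diagStabilizer_of_mem_zeroLocus`). If moreover `lam_i = f_i(y) * ν_i` on `E`, with
`y` off the hyperplanes and `ν` orthogonal to `U`, then an explicit curve over `x + ε y`
approaches `(x, lam)` within `Σ` (`mem_closure_criticalVariety_of_eq_mul`). So everything rests on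
a statement of linear algebra, `Submodule.dotPerp_diagStabilizer_subset_closure`: the products
`u * w` with `u ∈ U` and `w ∈ U.dotPerp` are dense in the orthogonal complement of the diagonal
stabilizer.

For this density it suffices, by the inverse function theorem and Chevalley's theorem, that the
differential of `(u, w) ↦ u * w` at one pair is onto that complement
(`Submodule.exists_isRegularPair`). Such a pair is found by induction, passing from `U` to its
deletion or contraction at some coordinate. One of the two does not enlarge the stabilizer
(`Submodule.diagStabilizer_deletion_or_contraction`), and orthogonality exchanges them.

If the rank is `ℓ`, the equations of `Σ` can be solved for the weights of `ℓ` independent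
hyperplanes, so that `Σ` is the graph of a rational map. Its vanishing ideal is prime, of height
`ℓ` by Krull's height theorem and the chain of primes obtained by imposing the equations one at a
time.
-/

/-! ### Subspaces of a coordinate space and their diagonal stabilizers -/

namespace Submodule

section Field

variable {𝕜 ι : Type*} [Field 𝕜]

/-- The orthogonal complement of `U` for the symmetric bilinear form `∑ i, u i * w i`
(no complex conjugation is involved, also over `ℂ`). -/
def dotPerp [Fintype ι] (U : Submodule 𝕜 (ι → 𝕜)) : Submodule 𝕜 (ι → 𝕜) where
  carrier := {w | ∀ u ∈ U, ∑ i, u i * w i = 0}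
  zero_mem' := by simp
  add_mem' {a b} ha hb u hu := by
    simp only [Pi.add_apply, mul_add, Finset.sum_add_distrib]
    rw [ha u hu, hb u hu, add_zero]
  smul_mem' r a ha u hu := by
    simp only [Pi.smul_apply, smul_eq_mul, mul_left_comm _ r, ← Finset.mul_sum]
    rw [ha u hu, mul_zero]

/-- The diagonal stabilizer of `U`: the vectors `t` such that the diagonal matrix with entries `t`
maps `U` into itself. -/
def diagStabilizer (U : Submodule 𝕜 (ι → 𝕜)) : Submodule 𝕜 (ι → 𝕜) where
  carrier := {t | ∀ u ∈ U, t * u ∈ U}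
  zero_mem' := by simp
  add_mem' {a b} ha hb u hu := by
    rw [add_mul]; exact U.add_mem (ha u hu) (hb u hu)
  smul_mem' r a ha u hu := by
    rw [smul_mul_assoc]; exact U.smul_mem r (ha u hu)

/-- The linear span of the `e`-th standard basis vector. -/
abbrev coordLine [DecidableEq ι] (𝕜 : Type*) [Field 𝕜] (e : ι) : Submodule 𝕜 (ι → 𝕜) :=
  span 𝕜 {Pi.single e 1}

/-- The coordinate hyperplane of the vectors whose `e`-th coordinate vanishes. -/
abbrev coordHyperplane (𝕜 : Type*) [Field 𝕜] (e : ι) : Submodule 𝕜 (ι → 𝕜) :=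
  LinearMap.ker (LinearMap.proj e)

lemma mem_sup_coordLine [DecidableEq ι] {U : Submodule 𝕜 (ι → 𝕜)} {e : ι} {v : ι → 𝕜} :
    v ∈ U ⊔ coordLine 𝕜 e ↔ ∃ α : 𝕜, v - α • Pi.single e 1 ∈ U := by
  rw [mem_sup]
  constructor
  · rintro ⟨u, hu, z, hz, rfl⟩
    obtain ⟨α, rfl⟩ := mem_span_singleton.1 hz
    exact ⟨α, by simpa using hu⟩
  · rintro ⟨α, h⟩
    exact ⟨_, h, _, mem_span_singleton.2 ⟨α, rfl⟩, by simp⟩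

lemma mem_inf_coordHyperplane {U : Submodule 𝕜 (ι → 𝕜)} {e : ι} {v : ι → 𝕜} :
    v ∈ U ⊓ coordHyperplane 𝕜 e ↔ v ∈ U ∧ v e = 0 := by
  simp

lemma exists_linearMap_ker_eq {V : Type*} [AddCommGroup V] [Module 𝕜 V] (W : Submodule 𝕜 V) :
    ∃ π : V →ₗ[𝕜] V, LinearMap.ker π = W := by
  obtain ⟨q, hq⟩ := W.exists_isCompl
  exact ⟨q.subtype ∘ₗ q.projectionOnto W hq.symm, by
    rw [LinearMap.ker_comp_of_ker_eq_bot _ q.ker_subtype, ker_projectionOnto]⟩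

/-- Let `U` not contain the `e`-th basis vector. Up to the `e`-th coordinate, one of the
deletion `U + 𝕜 e` and the contraction `U ∩ {u e = 0}` of `U` has no more diagonal stabilizer than
`U`. This is the linear counterpart of Tutte's theorem that a connected matroid stays connected
under the deletion or the contraction of any given element. -/
theorem diagStabilizer_deletion_or_contraction [DecidableEq ι] {U : Submodule 𝕜 (ι → 𝕜)} {e : ι}
    (he : Pi.single e 1 ∉ U) (hU : ∃ u ∈ U, u e ≠ 0) :
    (U ⊔ coordLine 𝕜 e).diagStabilizer ≤ U.diagStabilizer ⊔ coordLine 𝕜 e ∨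
      (U ⊓ coordHyperplane 𝕜 e).diagStabilizer ≤ U.diagStabilizer ⊔ coordLine 𝕜 e := by
  set ε : ι → 𝕜 := Pi.single e 1 with hε
  have εe : ε e = 1 := by simp [hε]
  have εi : ∀ i, i ≠ e → ε i = 0 := fun i hi ↦ by simp [hε, hi]
  by_contra! hcon
  obtain ⟨h1, h2⟩ := hcon
  obtain ⟨t, ht, htn⟩ := SetLike.not_le_iff_exists.1 h1
  obtain ⟨s, hs, hsn⟩ := SetLike.not_le_iff_exists.1 h2
  obtain ⟨w, hwU, hwe⟩ := hU
  -- Only the coordinates away from `e` matter: replace `t` and `s` by `t₀` and `s₀`,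
  -- whose `e`-th coordinate is zero.
  set t₀ : ι → 𝕜 := t - t e • ε with ht₀
  set s₀ : ι → 𝕜 := s - s e • ε with hs₀
  have t₀e : t₀ e = 0 := by simp [ht₀, εe]
  have s₀e : s₀ e = 0 := by simp [hs₀, εe]
  have hT : ∀ u ∈ U, ∃ α : 𝕜, t₀ * u - α • ε ∈ U := by
    intro u hu
    obtain ⟨α, hα⟩ := mem_sup_coordLine.1 (ht u (mem_sup_left hu))
    refine ⟨α - t e * u e, ?_⟩
    convert hα using 1
    ext i
    by_cases hi : i = e
    · subst hi; simp [ht₀, εe]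
    · simp [ht₀, hε, hi]
  have hS : ∀ v ∈ U, v e = 0 → s₀ * v ∈ U := by
    intro v hv hve
    have := (mem_inf_coordHyperplane.1 (hs v (mem_inf_coordHyperplane.2 ⟨hv, hve⟩))).1
    convert this using 1
    ext i
    by_cases hi : i = e
    · subst hi; simp [hve]
    · simp [hs₀, εi i hi]
  by_cases hc : ∀ v ∈ U, v e = 0 → t₀ * v ∈ U
  · -- `t₀` preserves the contraction, so a multiple of `ε` corrects `t₀` on all of `U`.
    apply htn
    obtain ⟨α, hα⟩ := hT ((w e)⁻¹ • w) (U.smul_mem _ hwU)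
    refine mem_sup_coordLine.2 ⟨t e + α, fun u hu ↦ ?_⟩
    have hv : u - u e • ((w e)⁻¹ • w) ∈ U := U.sub_mem hu (U.smul_mem _ (U.smul_mem _ hwU))
    have := U.add_mem (U.smul_mem (u e) hα) (hc _ hv (by simp [hwe]))
    convert this using 1
    ext i
    by_cases hi : i = e
    · subst hi; simp [ht₀, hwe, ← hε, εe]; ring
    · simp [ht₀, ← hε, εi i hi]; ring
  · push Not at hc
    obtain ⟨k, hk, hke, hkt⟩ := hc
    obtain ⟨α, hα⟩ := hT k hk
    have hα0 : α ≠ 0 := by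
      rintro rfl; exact hkt (by simpa using hα)
    -- After scaling, `t₀ * k - ε ∈ U`.
    obtain ⟨k, hk, hke, hkt⟩ : ∃ k ∈ U, k e = 0 ∧ t₀ * k - ε ∈ U := by
      refine ⟨α⁻¹ • k, U.smul_mem _ hk, by simp [hke], ?_⟩
      convert U.smul_mem α⁻¹ hα using 1
      rw [smul_sub, smul_smul, inv_mul_cancel₀ hα0, one_smul, mul_smul_comm]
    obtain ⟨c, hc⟩ := hT _ (hS k hk hke)
    apply hsn
    set s' : ι → 𝕜 := s₀ - c • 1 + c • ε with hs'
    have s'e : s' e = 0 := by simp [hs', s₀e, εe]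
    have s'i : ∀ i, i ≠ e → s' i = s₀ i - c := fun i hi ↦ by simp [hs', εi i hi]
    -- The map `v ↦ t₀ * (s' * v)` needs no correction by a multiple of `ε`.
    have hts : ∀ v ∈ U, v e = 0 → t₀ * (s' * v) ∈ U := by
      intro v hv hve
      obtain ⟨β, hβ⟩ := hT v hv
      have hv' : t₀ * (v - β • k) ∈ U := by
        convert U.sub_mem hβ (U.smul_mem β hkt) using 1
        ext i; simp; ring
      have h3 := hS _ hv' (by simp [t₀e])
      convert U.sub_mem (U.add_mem h3 (U.smul_mem β hc)) (U.smul_mem c hβ) using 1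
      ext i
      by_cases hi : i = e
      · subst hi; simp [t₀e, εe, s₀e]; ring
      · simp [s'i i hi, εi i hi]; ring
    have hs'D : s' ∈ U.diagStabilizer := by
      intro u hu
      have hv : u + u e • (t₀ * k - ε) ∈ U := U.add_mem hu (U.smul_mem _ hkt)
      have hve : (u + u e • (t₀ * k - ε)) e = 0 := by simp [t₀e, εe]
      have h1 := U.sub_mem (U.sub_mem (hS _ hv hve) (U.smul_mem c hv))
        (U.smul_mem (u e) (hts k hk hke))
      convert h1 using 1
      ext i
      by_cases hi : i = e
      · subst hi; simp [t₀e, εe, s₀e, s'e]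
      · simp [s'i i hi, εi i hi]; ring
    refine mem_sup_coordLine.2 ⟨s e - c, ?_⟩
    have h1D : (1 : ι → 𝕜) ∈ U.diagStabilizer := fun u hu ↦ by simpa using hu
    convert U.diagStabilizer.add_mem hs'D (U.diagStabilizer.smul_mem c h1D) using 1
    ext i
    by_cases hi : i = e
    · subst hi; simp [← hε, s'e, εe]
    · simp [← hε, s'i i hi, εi i hi, hs₀]

variable [Fintype ι]

lemma mem_dotPerp {U : Submodule 𝕜 (ι → 𝕜)} {w : ι → 𝕜} :
    w ∈ U.dotPerp ↔ ∀ u ∈ U, ∑ i, u i * w i = 0 := Iff.rfl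

lemma dotPerp_dotPerp (U : Submodule 𝕜 (ι → 𝕜)) : U.dotPerp.dotPerp = U := by
  classical
  have key : ∀ W : Submodule 𝕜 (ι → 𝕜),
      W.dotPerp = LinearMap.BilinForm.orthogonal (dotProductBilin 𝕜 𝕜) W := by
    intro W
    ext w
    simp [mem_dotPerp, LinearMap.BilinForm.mem_orthogonal_iff, dotProduct]
  have hrefl : (dotProductBilin 𝕜 𝕜 : LinearMap.BilinForm 𝕜 (ι → 𝕜)).IsRefl := by
    intro x y h
    simpa [dotProduct_comm] using h
  have hsep : ∀ x : ι → 𝕜, (∀ y, x ⬝ᵥ y = 0) → x = 0 := fun x hx ↦ by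
    ext i
    simpa using hx (Pi.single i 1)
  have hnd : (dotProductBilin 𝕜 𝕜 : LinearMap.BilinForm 𝕜 (ι → 𝕜)).Nondegenerate :=
    ⟨fun x hx ↦ hsep x hx, fun x hx ↦ hsep x fun y ↦ by simpa [dotProduct_comm] using hx y⟩
  rw [key, key, LinearMap.BilinForm.orthogonal_orthogonal hnd hrefl]

lemma dotPerp_le_dotPerp {U W : Submodule 𝕜 (ι → 𝕜)} (h : U ≤ W) : W.dotPerp ≤ U.dotPerp :=
  fun _ hw u hu ↦ hw u (h hu)

lemma diagStabilizer_dotPerp (U : Submodule 𝕜 (ι → 𝕜)) :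
    U.dotPerp.diagStabilizer = U.diagStabilizer := by
  have key : ∀ W : Submodule 𝕜 (ι → 𝕜), W.diagStabilizer ≤ W.dotPerp.diagStabilizer := by
    intro W t ht w hw u hu
    have := hw _ (ht u hu)
    simpa [mul_assoc, mul_left_comm] using this
  exact le_antisymm (by simpa [dotPerp_dotPerp] using key U.dotPerp) (key U)

lemma mul_mem_iff {U : Submodule 𝕜 (ι → 𝕜)} {t u : ι → 𝕜} :
    t * u ∈ U ↔ ∀ w ∈ U.dotPerp, ∑ i, t i * (u i * w i) = 0 := by
  conv_lhs => rw [← dotPerp_dotPerp U]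
  rw [mem_dotPerp]
  refine forall₂_congr fun w _ ↦ ?_
  simp only [Pi.mul_apply, mul_comm, mul_left_comm]

variable [DecidableEq ι]

lemma dotPerp_sup_coordLine (U : Submodule 𝕜 (ι → 𝕜)) (e : ι) :
    (U ⊔ coordLine 𝕜 e).dotPerp = U.dotPerp ⊓ coordHyperplane 𝕜 e := by
  ext w
  rw [mem_inf_coordHyperplane]
  constructor
  · intro h
    refine ⟨dotPerp_le_dotPerp le_sup_left h, ?_⟩
    have := h (Pi.single e 1) (mem_sup_right (mem_span_singleton_self _))
    simpa [Pi.single_apply] using this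
  · rintro ⟨h, he⟩ u hu
    obtain ⟨α, hα⟩ := mem_sup_coordLine.1 hu
    have := h _ hα
    simpa [sub_mul, Finset.sum_sub_distrib, Pi.single_apply, he] using this

lemma dotPerp_inf_coordHyperplane (U : Submodule 𝕜 (ι → 𝕜)) (e : ι) :
    (U ⊓ coordHyperplane 𝕜 e).dotPerp = U.dotPerp ⊔ coordLine 𝕜 e := by
  rw [← dotPerp_dotPerp (U.dotPerp ⊔ coordLine 𝕜 e), dotPerp_sup_coordLine, dotPerp_dotPerp]

/-- A basis vector `Pi.single e 1` outside `U` is detected by a vector of `U.dotPerp`. -/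
lemma single_mem_iff {U : Submodule 𝕜 (ι → 𝕜)} {e : ι} :
    Pi.single e 1 ∈ U ↔ ∀ w ∈ U.dotPerp, w e = 0 := by
  conv_lhs => rw [← dotPerp_dotPerp U]
  simp [mem_dotPerp, Pi.single_apply]

end Field

/-! ### Pairs of orthogonal vectors in general position -/

section Complex

variable {ι : Type*} [Fintype ι]

/-- A pair `(u, w)`, meant to lie in `U × U.dotPerp`, is regular if only the diagonal stabilizer of
`U` multiplies `u` into `U` and `w` into `U.dotPerp`. Equivalently, the differential of
`(u, w) ↦ u * w` at the pair has the largest possible image, namely `U.diagStabilizer.dotPerp`. -/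
def IsRegularPair (U : Submodule ℂ (ι → ℂ)) (u w : ι → ℂ) : Prop :=
  ∀ t : ι → ℂ, t * u ∈ U → t * w ∈ U.dotPerp → t ∈ U.diagStabilizer

variable {U : Submodule ℂ (ι → ℂ)} {u w : ι → ℂ}

lemma isRegularPair_dotPerp_iff : IsRegularPair U.dotPerp w u ↔ IsRegularPair U u w := by
  simp only [IsRegularPair, dotPerp_dotPerp, diagStabilizer_dotPerp]
  exact forall_congr' fun t ↦ ⟨fun h a b ↦ h b a, fun h a b ↦ h b a⟩

/-- Regularity is an open condition, so the first vector of a regular pair may be moved off a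
coordinate hyperplane which does not contain `U`. -/
lemma IsRegularPair.exists_ne_zero (h : IsRegularPair U u w) (hu : u ∈ U) (hw : w ∈ U.dotPerp)
    {e : ι} {v : ι → ℂ} (hv : v ∈ U) (hve : v e ≠ 0) :
    ∃ s : ℂ, (u + s • v) e ≠ 0 ∧ IsRegularPair U (u + s • v) w := by
  by_cases hue : u e ≠ 0
  · exact ⟨0, by simpa using hue, by simpa using h⟩
  push Not at hue
  obtain ⟨C, hC⟩ := U.diagStabilizer.exists_isCompl
  obtain ⟨πU, hπU⟩ := exists_linearMap_ker_eq U
  obtain ⟨πW, hπW⟩ := exists_linearMap_ker_eq U.dotPerp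
  obtain ⟨πC, hπC⟩ := exists_linearMap_ker_eq C
  have hπU' : ∀ x, πU x = 0 ↔ x ∈ U := fun x ↦ by rw [← LinearMap.mem_ker, hπU]
  have hπW' : ∀ x, πW x = 0 ↔ x ∈ U.dotPerp := fun x ↦ by rw [← LinearMap.mem_ker, hπW]
  have hπC' : ∀ x, πC x = 0 ↔ x ∈ C := fun x ↦ by rw [← LinearMap.mem_ker, hπC]
  -- `A + s • B` is injective if and only if `(u + s • v, w)` is regular.
  let A : (ι → ℂ) →ₗ[ℂ] (ι → ℂ) × (ι → ℂ) × (ι → ℂ) :=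
    (πU ∘ₗ LinearMap.mulRight ℂ u).prod ((πW ∘ₗ LinearMap.mulRight ℂ w).prod πC)
  let B : (ι → ℂ) →ₗ[ℂ] (ι → ℂ) × (ι → ℂ) × (ι → ℂ) :=
    (πU ∘ₗ LinearMap.mulRight ℂ v).prod 0
  have hAB : ∀ (s : ℂ) (t : ι → ℂ), (A + s • B) t = 0 ↔
      t * (u + s • v) ∈ U ∧ t * w ∈ U.dotPerp ∧ t ∈ C := by
    intro s t
    simp only [← hπU', ← hπW', ← hπC']
    simp [A, B, Prod.ext_iff, mul_add]
  let L : ℂ → ((ι → ℂ) →L[ℂ] (ι → ℂ) × (ι → ℂ) × (ι → ℂ)) := fun s ↦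
    LinearMap.toContinuousLinearMap A + s • LinearMap.toContinuousLinearMap B
  have hL : Continuous L := by fun_prop
  have hLapp : ∀ s t, L s t = (A + s • B) t := fun s t ↦ by simp [L]
  have h0 : Function.Injective (L 0) := by
    rw [injective_iff_map_eq_zero]
    intro t ht
    rw [hLapp, hAB] at ht
    obtain ⟨h1, h2, h3⟩ := ht
    exact (Submodule.disjoint_def.1 hC.disjoint) t (h t (by simpa using h1) h2) h3
  have hopen := (ContinuousLinearMap.isOpen_injective.preimage hL).mem_nhds h0
  obtain ⟨s, hsL, hs0⟩ : ∃ s : ℂ, Function.Injective (L s) ∧ s ≠ 0 := by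
    have := (nhdsWithin_le_nhds (s := {0}ᶜ) hopen)
    exact ((Filter.Eventually.and this self_mem_nhdsWithin).exists)
  refine ⟨s, by simp [hue, hs0, hve], fun t htU htW ↦ ?_⟩
  obtain ⟨d, hd, c, hc, rfl⟩ := mem_sup.1 (hC.sup_eq_top ▸ mem_top : t ∈ U.diagStabilizer ⊔ C)
  have hd' : d ∈ U.dotPerp.diagStabilizer := by rwa [diagStabilizer_dotPerp]
  have hc0 : L s c = 0 := by
    rw [hLapp, hAB]
    refine ⟨?_, ?_, hc⟩
    · have := U.sub_mem htU (hd _ (U.add_mem hu (U.smul_mem s hv)))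
      rwa [add_mul, add_sub_cancel_left] at this
    · have := U.dotPerp.sub_mem htW (hd' _ hw)
      rwa [add_mul, add_sub_cancel_left] at this
  rw [(injective_iff_map_eq_zero _).1 hsL c hc0, add_zero]
  exact hd

variable [DecidableEq ι]

/-- Regular pairs pass from the deletion `U + ℂ e` to `U` if the deletion has no new diagonal
stabilizer. The space `U` is recovered from the deletion by correcting the `e`-th coordinate of `u`,
which is then made nonzero by a perturbation. -/
lemma exists_isRegularPair_of_deletion {e : ι} (he : Pi.single e 1 ∉ U) (hU : ∃ u ∈ U, u e ≠ 0)
    (hD : (U ⊔ coordLine ℂ e).diagStabilizer ≤ U.diagStabilizer ⊔ coordLine ℂ e)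
    (hreg : ∃ u ∈ U ⊔ coordLine ℂ e, ∃ w ∈ (U ⊔ coordLine ℂ e).dotPerp,
      IsRegularPair (U ⊔ coordLine ℂ e) u w) :
    ∃ u ∈ U, ∃ w ∈ U.dotPerp, IsRegularPair U u w := by
  obtain ⟨u₁, hu₁, w, hw, h₁⟩ := hreg
  obtain ⟨v, hv, hve⟩ := hU
  obtain ⟨α, hα⟩ := mem_sup_coordLine.1 hu₁
  have hsingle : ∀ x : ℂ, x • Pi.single e 1 ∈ U ⊔ coordLine ℂ e := fun x ↦
    mem_sup_right (smul_mem _ _ (mem_span_singleton_self _))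
  have h₂ : IsRegularPair (U ⊔ coordLine ℂ e) (u₁ - α • Pi.single e 1) w := by
    refine fun t htu htw ↦ h₁ t ?_ htw
    convert add_mem htu (hsingle (t e * α)) using 1
    ext i
    by_cases hi : i = e
    · subst hi; simp; ring
    · simp [hi]
  obtain ⟨s, hse, h₃⟩ := h₂.exists_ne_zero (mem_sup_left hα) hw (mem_sup_left hv) hve
  have hu := U.add_mem hα (U.smul_mem s hv)
  set u := u₁ - α • Pi.single e 1 + s • v
  refine ⟨u, hu, w, dotPerp_le_dotPerp le_sup_left hw, fun t htu htw ↦ ?_⟩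
  have hwe : w e = 0 := by
    rw [dotPerp_sup_coordLine, mem_inf_coordHyperplane] at hw
    exact hw.2
  have ht := hD (h₃ t (mem_sup_left htu) (by
    rw [dotPerp_sup_coordLine, mem_inf_coordHyperplane]
    exact ⟨htw, by simp [hwe]⟩))
  -- Write `t = d + β • Pi.single e 1` with `d` stabilizing `U`; then the multiple of the basis
  -- vector by `β * u e` lies in `U`.
  obtain ⟨β, hβ⟩ := mem_sup_coordLine.1 ht
  have hmem : (β * u e) • (Pi.single e 1 : ι → ℂ) ∈ U := by
    convert U.sub_mem htu (hβ u hu) using 1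
    ext i
    by_cases hi : i = e
    · subst hi; simp; ring
    · simp [hi]
  have hβ0 : β = 0 := by
    by_contra hβ0
    exact he ((U.smul_mem_iff (mul_ne_zero hβ0 hse)).1 hmem)
  simpa [hβ0] using hβ

/-- Every subspace has a regular pair. The proof is by induction on the number of coordinates that
are neither loops (zero on `U`) nor coloops (with the basis vector in `U`): both the deletion and
the contraction of such a coordinate lower this number, and they are exchanged by
`U ↦ U.dotPerp`. -/
theorem exists_isRegularPair (U : Submodule ℂ (ι → ℂ)) :
    ∃ u ∈ U, ∃ w ∈ U.dotPerp, IsRegularPair U u w := by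
  classical
  induction h : (Finset.univ.filter fun e : ι ↦ Pi.single e 1 ∉ U ∧ ∃ u ∈ U, u e ≠ 0).card
    using Nat.strong_induction_on generalizing U with
  | _ n ih =>
  by_cases hbad : ∃ e : ι, Pi.single e 1 ∉ U ∧ ∃ u ∈ U, u e ≠ 0
  · obtain ⟨e, he, hU⟩ := hbad
    have hlt : ∀ V : Submodule ℂ (ι → ℂ),
        (∀ i, (Pi.single i 1 ∉ V ∧ ∃ u ∈ V, u i ≠ 0) →
          i ≠ e ∧ Pi.single i 1 ∉ U ∧ ∃ u ∈ U, u i ≠ 0) →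
        ∃ u ∈ V, ∃ w ∈ V.dotPerp, IsRegularPair V u w := by
      intro V hV
      refine ih _ ?_ V rfl
      rw [← h]
      refine Finset.card_lt_card ⟨fun i hi ↦ ?_, fun hsub ↦ ?_⟩
      · simpa using (hV i (by simpa using hi)).2
      · have := hsub (Finset.mem_filter.2 ⟨Finset.mem_univ e, he, hU⟩)
        exact (hV e (Finset.mem_filter.1 this).2).1 rfl
    rcases diagStabilizer_deletion_or_contraction he hU with hD | hD
    · refine exists_isRegularPair_of_deletion he hU hD (hlt _ ?_)
      rintro i ⟨h1, v, hv, hvi⟩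
      have hie : i ≠ e := by
        rintro rfl
        exact h1 (mem_sup_right (mem_span_singleton_self _))
      refine ⟨hie, fun h2 ↦ h1 (mem_sup_left h2), ?_⟩
      obtain ⟨α, hα⟩ := mem_sup_coordLine.1 hv
      exact ⟨_, hα, by simpa [hie] using hvi⟩
    · have hreg := hlt (U ⊓ coordHyperplane ℂ e) (by
        rintro i ⟨h1, v, hv, hvi⟩
        obtain ⟨hvU, hve⟩ := mem_inf_coordHyperplane.1 hv
        have hie : i ≠ e := by
          rintro rfl
          exact hvi hve
        exact ⟨hie, fun h2 ↦ h1 (mem_inf_coordHyperplane.2 ⟨h2, by simp [hie.symm]⟩),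
          v, hvU, hvi⟩)
      -- The orthogonal complement of the contraction of `U` is the deletion of `U.dotPerp`.
      have hperp := dotPerp_inf_coordHyperplane U e
      have hdual : ∃ w ∈ U.dotPerp, ∃ u ∈ U.dotPerp.dotPerp, IsRegularPair U.dotPerp w u := by
        refine exists_isRegularPair_of_deletion (e := e) ?_ ?_ ?_ ?_
        · obtain ⟨u, hu, hue⟩ := hU
          intro hmem
          exact hue (single_mem_iff.1 hmem u (by rwa [dotPerp_dotPerp]))
        · by_contra! hcon
          exact he (single_mem_iff.2 hcon)
        · rwa [← hperp, diagStabilizer_dotPerp, diagStabilizer_dotPerp]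
        · obtain ⟨u, hu, w, hw, hr⟩ := hreg
          rw [← hperp]
          exact ⟨w, hw, u, by rwa [dotPerp_dotPerp], isRegularPair_dotPerp_iff.2 hr⟩
      obtain ⟨w, hw, u, hu, hr⟩ := hdual
      rw [dotPerp_dotPerp] at hu
      exact ⟨u, hu, w, hw, isRegularPair_dotPerp_iff.1 hr⟩
  · -- Without such coordinates, `U` is a coordinate subspace, stable under all diagonal matrices.
    push Not at hbad
    refine ⟨0, U.zero_mem, 0, zero_mem _, fun t _ _ u hu ↦ ?_⟩
    rw [pi_eq_sum_univ (t * u)]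
    refine U.sum_mem fun i _ ↦ ?_
    by_cases hi : Pi.single i 1 ∈ U
    · refine U.smul_mem _ ?_
      convert hi using 1
      ext j
      simp [Pi.single_apply, eq_comm]
    · simp [hbad i hi u hu]

end Complex
end Submodule

/-! ### Zero sets and images of polynomial maps -/

namespace MvPolynomial

open Topology

lemma eq_zero_of_forall_mem_isOpen {ι : Type*} [Finite ι] {P : MvPolynomial ι ℂ}
    {O : Set (ι → ℂ)} (hO : IsOpen O) (hne : O.Nonempty) (h : ∀ y ∈ O, eval y P = 0) : P = 0 := by
  obtain ⟨y, hy⟩ := hne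
  have := Fintype.ofFinite ι
  obtain ⟨r, hr, hball⟩ := Metric.isOpen_iff.1 hO y hy
  refine funext_set (fun i ↦ Metric.ball (y i) r)
    (fun i ↦ infinite_of_mem_nhds (y i) (Metric.ball_mem_nhds _ hr)) fun x hx ↦ ?_
  rw [map_zero]
  refine h x (hball ?_)
  rw [ball_pi _ hr]
  exact hx

lemma dense_setOf_eval_ne_zero {ι : Type*} [Finite ι] {D : MvPolynomial ι ℂ} (hD : D ≠ 0) :
    Dense {y : ι → ℂ | eval y D ≠ 0} := by
  rw [dense_iff_inter_open]
  intro O hO hne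
  by_contra hcon
  refine hD (eq_zero_of_forall_mem_isOpen hO hne fun y hy ↦ ?_)
  by_contra hy0
  exact hcon ⟨y, hy, hy0⟩

lemma isClosed_zeroLocus {σ : Type*} (J : Ideal (MvPolynomial σ ℂ)) :
    IsClosed (zeroLocus ℂ J : Set (σ → ℂ)) := by
  have : (zeroLocus ℂ J : Set (σ → ℂ)) = ⋂ s ∈ J, {p | eval p s = 0} := by
    ext p; simp [mem_zeroLocus_iff, aeval_eq_eval]
  rw [this]
  exact isClosed_biInter fun s _ ↦ isClosed_eq (continuous_eval s) continuous_const

lemma vanishingIdeal_closure {σ : Type*} (Z : Set (σ → ℂ)) :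
    vanishingIdeal ℂ (closure Z) = vanishingIdeal ℂ Z := by
  refine le_antisymm (vanishingIdeal_anti_mono subset_closure) fun f hf ↦ ?_
  have hcl : IsClosed {p : σ → ℂ | eval p f = 0} := isClosed_eq (continuous_eval f) continuous_const
  intro p hp
  rw [aeval_eq_eval]
  exact closure_minimal (fun x hx ↦ by simpa [aeval_eq_eval] using hf x hx) hcl hp

/-- If the range of a polynomial map has an interior point, then it contains the complement of a
hypersurface: by Chevalley's theorem the range is constructible, and a constructible set containing
the generic point contains a nonempty Zariski open set. -/
theorem exists_ne_zero_forall_mem_range {κ ι : Type*} [Finite κ] [Finite ι]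
    (F : ι → MvPolynomial κ ℂ) {O : Set (ι → ℂ)} (hO : IsOpen O) (hne : O.Nonempty)
    (hsub : O ⊆ Set.range fun (x : κ → ℂ) i ↦ eval x (F i)) :
    ∃ D : MvPolynomial ι ℂ, D ≠ 0 ∧
      ∀ y, eval y D ≠ 0 → y ∈ Set.range fun (x : κ → ℂ) i ↦ eval x (F i) := by
  let φ : MvPolynomial ι ℂ →+* MvPolynomial κ ℂ := (aeval F).toRingHom
  have hφ : ∀ x P, eval x (φ P) = eval (fun i ↦ eval x (F i)) P := by
    intro x P
    have : (eval x).comp φ = eval (fun i ↦ eval x (F i)) := by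
      ext <;> simp [φ]
    exact congrArg (fun g : MvPolynomial ι ℂ →+* ℂ ↦ g P) this
  have hinj : Function.Injective φ := by
    rw [injective_iff_map_eq_zero]
    intro P hP
    refine eq_zero_of_forall_mem_isOpen hO hne fun y hy ↦ ?_
    obtain ⟨x, rfl⟩ := hsub hy
    rw [← hφ, hP, map_zero]
  have hfp : φ.FinitePresentation := by
    refine RingHom.FinitePresentation.of_finiteType.1 ?_
    refine RingHom.FiniteType.of_comp_finiteType (f := algebraMap ℂ (MvPolynomial ι ℂ)) ?_
    have : φ.comp (algebraMap ℂ (MvPolynomial ι ℂ)) = algebraMap ℂ (MvPolynomial κ ℂ) :=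
      (aeval F).comp_algebraMap
    rw [this, RingHom.finiteType_algebraMap]
    infer_instance
  obtain ⟨S, hS⟩ := PrimeSpectrum.exists_constructibleSetData_iff.2
    (PrimeSpectrum.isConstructible_range_comap hfp)
  have hbot : (⊥ : PrimeSpectrum (MvPolynomial ι ℂ)) ∈ S.toSet := by
    rw [hS]
    refine ⟨⊥, ?_⟩
    ext P
    simp [PrimeSpectrum.comap_asIdeal, PrimeSpectrum.asIdeal_bot, hinj.eq_iff' (map_zero φ)]
  obtain ⟨T, hT, hTbot⟩ := Set.mem_iUnion₂.1 hbot
  have hg : ∀ i, T.g i = 0 := by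
    intro i
    simpa using hTbot.1 ⟨i, rfl⟩
  refine ⟨T.f, fun hf ↦ hTbot.2 (by simp [hf]), fun y hy ↦ ?_⟩
  have hmem : pointToPoint (k := ℂ) y ∈ S.toSet := by
    refine Set.mem_iUnion₂.2 ⟨T, hT, ?_, ?_⟩
    · rintro _ ⟨i, rfl⟩
      simp [hg i]
    · intro h
      have := h rfl
      exact hy ((mem_vanishingIdeal_singleton_iff y T.f).1 this)
  rw [hS] at hmem
  obtain ⟨p, hp⟩ := hmem
  obtain ⟨M, hM, hpM⟩ := Ideal.exists_le_maximal p.asIdeal p.isPrime.ne_top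
  obtain ⟨x, rfl⟩ := isMaximal_iff_eq_vanishingIdeal_singleton.1 hM
  refine ⟨x, _root_.funext fun i ↦ ?_⟩
  have h1 : X i - C (y i) ∈ (PrimeSpectrum.comap φ p).asIdeal := by
    rw [hp]
    exact (mem_vanishingIdeal_singleton_iff y _).2 (by simp)
  have h2 := (mem_vanishingIdeal_singleton_iff x _).1 (hpM h1)
  have h3 : eval x (φ (X i - C (y i))) = 0 := by simpa using h2
  rw [hφ] at h3
  simpa [sub_eq_zero] using h3

end MvPolynomial

/-! ### Density of the products of orthogonal vectors -/

namespace Submodule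

open Topology

variable {ι : Type*} [Fintype ι]

lemma mul_mem_dotPerp_diagStabilizer {U : Submodule ℂ (ι → ℂ)} {u w : ι → ℂ} (hu : u ∈ U)
    (hw : w ∈ U.dotPerp) : u * w ∈ U.diagStabilizer.dotPerp := by
  intro t ht
  simpa [mul_assoc] using hw _ (ht u hu)

/-- A subspace is the image of a polynomial (in fact linear) parametrization. -/
lemma exists_range_eval_eq (V : Submodule ℂ (ι → ℂ)) :
    ∃ (m : ℕ) (F : ι → MvPolynomial (Fin m) ℂ),
      Set.range (fun (x : Fin m → ℂ) i ↦ eval x (F i)) = V := by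
  let b := Module.finBasis ℂ V
  refine ⟨_, fun i ↦ ∑ j, C ((b j).1 i) * X j, ?_⟩
  have hF : ∀ x : Fin (Module.finrank ℂ V) → ℂ,
      (fun i ↦ eval x (∑ j, C ((b j).1 i) * X j)) = (∑ j, x j • b j : V).1 := by
    intro x
    ext i
    simp [mul_comm]
  ext v
  constructor
  · rintro ⟨x, rfl⟩
    dsimp only
    rw [hF]
    exact Subtype.prop _
  · intro hv
    exact ⟨b.repr ⟨v, hv⟩, by dsimp only; rw [hF, b.sum_repr]⟩

/-- The case of the polynomial map `(u, w, z) ↦ u * w + z` on a product of subspaces. -/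
lemma exists_ne_zero_forall_mem_mul_add (U W N : Submodule ℂ (ι → ℂ)) {O : Set (ι → ℂ)}
    (hO : IsOpen O) (hne : O.Nonempty)
    (hsub : O ⊆ {y | ∃ u ∈ U, ∃ w ∈ W, ∃ z ∈ N, u * w + z = y}) :
    ∃ D : MvPolynomial ι ℂ, D ≠ 0 ∧
      ∀ y, eval y D ≠ 0 → ∃ u ∈ U, ∃ w ∈ W, ∃ z ∈ N, u * w + z = y := by
  obtain ⟨a, F₁, h₁⟩ := exists_range_eval_eq U
  obtain ⟨b, F₂, h₂⟩ := exists_range_eval_eq W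
  obtain ⟨c, F₃, h₃⟩ := exists_range_eval_eq N
  simp only [Set.ext_iff, SetLike.mem_coe] at h₁ h₂ h₃
  let F : ι → MvPolynomial (Fin a ⊕ Fin b ⊕ Fin c) ℂ := fun i ↦
    rename .inl (F₁ i) * rename (.inr ∘ .inl) (F₂ i) + rename (.inr ∘ .inr) (F₃ i)
  have hF : {y | ∃ u ∈ U, ∃ w ∈ W, ∃ z ∈ N, u * w + z = y} ⊆
      Set.range fun (x : Fin a ⊕ Fin b ⊕ Fin c → ℂ) i ↦ eval x (F i) := by
    rintro _ ⟨u, hu, w, hw, z, hz, rfl⟩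
    obtain ⟨x₁, rfl⟩ := (h₁ u).2 hu
    obtain ⟨x₂, rfl⟩ := (h₂ w).2 hw
    obtain ⟨x₃, rfl⟩ := (h₃ z).2 hz
    refine ⟨Sum.elim x₁ (Sum.elim x₂ x₃), ?_⟩
    ext i
    simp [F, eval_rename, Function.comp_def]
  obtain ⟨D, hD, h⟩ := exists_ne_zero_forall_mem_range F hO hne (hsub.trans hF)
  refine ⟨D, hD, fun y hy ↦ ?_⟩
  obtain ⟨x, rfl⟩ := h y hy
  refine ⟨_, (h₁ _).1 ⟨x ∘ .inl, rfl⟩, _, (h₂ _).1 ⟨x ∘ .inr ∘ .inl, rfl⟩,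
    _, (h₃ _).1 ⟨x ∘ .inr ∘ .inr, rfl⟩, ?_⟩
  ext i
  simp [F, eval_rename]

/-- The products `u * w` with `u ∈ U` and `w ∈ U.dotPerp` are dense in the space
`U.diagStabilizer.dotPerp` containing them. The differential at a regular pair is onto that space;
to work with open subsets of the full coordinate space, a complement `N'` is added. -/
theorem dotPerp_diagStabilizer_subset_closure (U : Submodule ℂ (ι → ℂ)) :
    (U.diagStabilizer.dotPerp : Set (ι → ℂ)) ⊆
      closure {y | ∃ u ∈ U, ∃ w ∈ U.dotPerp, u * w = y} := by
  classical
  obtain ⟨u₀, hu₀, w₀, hw₀, hreg⟩ := exists_isRegularPair U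
  set N := U.diagStabilizer.dotPerp with hN
  obtain ⟨N', hN'⟩ := N.exists_isCompl
  let A₁ : U × U.dotPerp × N' →L[ℂ] (ι → ℂ) := U.subtypeL.comp (.fst ℂ _ _)
  let A₂ : U × U.dotPerp × N' →L[ℂ] (ι → ℂ) :=
    U.dotPerp.subtypeL.comp ((ContinuousLinearMap.fst ℂ _ _).comp (.snd ℂ _ _))
  let A₃ : U × U.dotPerp × N' →L[ℂ] (ι → ℂ) :=
    N'.subtypeL.comp ((ContinuousLinearMap.snd ℂ _ _).comp (.snd ℂ _ _))
  let G : U × U.dotPerp × N' → (ι → ℂ) := fun p ↦ A₁ p * A₂ p + A₃ p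
  let p₀ : U × U.dotPerp × N' := (⟨u₀, hu₀⟩, ⟨w₀, hw₀⟩, 0)
  have hrange : Set.range G ∈ 𝓝 (G p₀) := by
    have hG := ((A₁.hasStrictFDerivAt (x := p₀)).mul A₂.hasStrictFDerivAt).add A₃.hasStrictFDerivAt
    have := hG.map_nhds_eq_of_surj ?_
    · change Filter.map G (𝓝 p₀) = 𝓝 (G p₀) at this
      rw [← this]
      exact Filter.mem_map.2 (Filter.mem_of_superset Filter.univ_mem fun x _ ↦ ⟨x, rfl⟩)
    · -- A vector orthogonal to the range of the differential is orthogonal to `N` and to `N'`.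
      rw [← dotPerp_dotPerp (LinearMap.range _), eq_top_iff]
      refine fun v _ t ht ↦ ?_
      have h1 : ∀ (u : U) (w : U.dotPerp) (z : N'),
          ∑ i, (u₀ i * w.1 i + u.1 i * w₀ i + z.1 i) * t i = 0 := by
        intro u w z
        have := ht _ ⟨(u, w, z), rfl⟩
        convert this using 3 with i
        simp [A₁, A₂, A₃, p₀, mul_comm]
      have htD : t ∈ U.diagStabilizer := by
        refine hreg t (mul_mem_iff.2 fun w hw ↦ ?_) fun u hu ↦ ?_
        · simpa [mul_comm] using h1 0 ⟨w, hw⟩ 0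
        · simpa [mul_comm, mul_left_comm, mul_assoc] using h1 ⟨u, hu⟩ 0 0
      obtain ⟨a, ha, z, hz, rfl⟩ := mem_sup.1 (hN'.sup_eq_top ▸ mem_top : v ∈ N ⊔ N')
      have h2 := h1 0 0 ⟨z, hz⟩
      have h3 := ha t htD
      simp only [Pi.add_apply, mul_add, Finset.sum_add_distrib, h3, zero_add]
      simpa [mul_comm] using h2
  have hGS : Set.range G = {y | ∃ u ∈ U, ∃ w ∈ U.dotPerp, ∃ z ∈ N', u * w + z = y} := by
    ext y
    constructor
    · rintro ⟨⟨u, w, z⟩, rfl⟩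
      exact ⟨u, u.2, w, w.2, z, z.2, rfl⟩
    · rintro ⟨u, hu, w, hw, z, hz, rfl⟩
      exact ⟨(⟨u, hu⟩, ⟨w, hw⟩, ⟨z, hz⟩), rfl⟩
  rw [hGS] at hrange
  obtain ⟨D, hD, hDG⟩ := exists_ne_zero_forall_mem_mul_add U U.dotPerp N' isOpen_interior
    ⟨_, mem_interior_iff_mem_nhds.2 hrange⟩ interior_subset
  -- Project along `N'`, which does not move the products.
  intro y hy
  let π : (ι → ℂ) →ₗ[ℂ] (ι → ℂ) := N.subtype ∘ₗ N.projectionOnto N' hN'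
  have hπ : ∀ a ∈ N, ∀ z ∈ N', π (a + z) = a := by
    intro a ha z hz
    rw [map_add]
    have h1 : N.projectionOnto N' hN' a = ⟨a, ha⟩ :=
      projectionOnto_apply_left hN' ⟨a, ha⟩
    have h2 : N.projectionOnto N' hN' z = 0 :=
      (projectionOnto_apply_eq_zero_iff hN').2 hz
    simp [π, h1, h2]
  have hπc : Continuous π := π.continuous_of_finiteDimensional
  have hcl := image_closure_subset_closure_image hπc
    ⟨y, dense_setOf_eval_ne_zero hD y, rfl⟩
  rw [← add_zero y, hπ y hy 0 N'.zero_mem] at hcl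
  refine closure_mono ?_ hcl
  rintro _ ⟨y', hy', rfl⟩
  obtain ⟨u, hu, w, hw, z, hz, rfl⟩ := hDG y' hy'
  exact ⟨u, hu, w, hw, (hπ _ (mul_mem_dotPerp_diagStabilizer hu hw) z hz).symm⟩

end Submodule

/-! ### The logarithmic ideal -/

namespace CentralArrangement

variable {ℓ n : ℕ} (A : CentralArrangement ℓ n)

lemma eval_form (i : Fin n) (x : Fin ℓ → ℂ) : eval x (A.form i) = ∑ j, A.c i j * x j := by
  simp [form]

lemma form_ne_zero (i : Fin n) : A.form i ≠ 0 := by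
  intro h
  refine A.ne_zero i (funext fun j ↦ ?_)
  have := A.eval_form i (Pi.single j 1)
  simpa [h, Pi.single_apply] using this.symm

lemma definingPoly_ne_zero : A.definingPoly ≠ 0 :=
  Finset.prod_ne_zero_iff.2 fun i _ ↦ A.form_ne_zero i

lemma eval_definingPoly_ne_zero_iff {x : Fin ℓ → ℂ} :
    eval x A.definingPoly ≠ 0 ↔ x ∈ A.complement := by
  simp [definingPoly, complement, Finset.prod_ne_zero_iff]

lemma dense_complement : Dense A.complement := by
  have := dense_setOf_eval_ne_zero A.definingPoly_ne_zero
  simpa only [eval_definingPoly_ne_zero_iff, Set.ofPred_mem_eq] using this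

lemma rename_form_ne_zero (i : Fin n) :
    algebraMap (CoordRing ℓ n) (FractionRing (CoordRing ℓ n)) (rename Sum.inl (A.form i)) ≠ 0 := by
  rw [Ne, FaithfulSMul.algebraMap_eq_zero_iff]
  exact fun h ↦ A.form_ne_zero i (rename_injective _ Sum.inl_injective (by rw [h, map_zero]))

lemma eval_rename_inl (p : Fin ℓ ⊕ Fin n → ℂ) (f : MvPolynomial (Fin ℓ) ℂ) :
    eval p (rename Sum.inl f) = eval (fun k ↦ p (Sum.inl k)) f := by
  rw [eval_rename]; rfl

/-- A derivation is determined on a linear form by its values on the coordinates. -/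
lemma derivation_form (θ : Derivation ℂ (MvPolynomial (Fin ℓ) ℂ) (MvPolynomial (Fin ℓ) ℂ))
    (i : Fin n) : θ (A.form i) = ∑ j, C (A.c i j) * θ (X j) := by
  simp [form, C_mul']

/-- If the pairing with `θ` is the polynomial `s`, then `s` takes the expected value at the points
where no form vanishes. -/
lemma eval_of_algebraMap_eq_pairing
    {θ : Derivation ℂ (MvPolynomial (Fin ℓ) ℂ) (MvPolynomial (Fin ℓ) ℂ)} {s : CoordRing ℓ n}
    (hs : algebraMap (CoordRing ℓ n) (FractionRing (CoordRing ℓ n)) s = A.pairing θ)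
    {p : Fin ℓ ⊕ Fin n → ℂ} (hp : (fun j ↦ p (Sum.inl j)) ∈ A.complement) :
    eval p s = ∑ j, eval (fun k ↦ p (Sum.inl k)) (θ (X j)) *
      ∑ i, p (Sum.inr i) * A.c i j / eval (fun k ↦ p (Sum.inl k)) (A.form i) := by
  classical
  set x : Fin ℓ → ℂ := fun j ↦ p (Sum.inl j)
  have hp' : ∀ i, eval x (A.form i) ≠ 0 := hp
  let q : CoordRing ℓ n := ∏ i, rename Sum.inl (A.form i)
  -- Multiplying by `q` clears all denominators of the pairing.
  have hpoly : s * q = ∑ j, rename Sum.inl (θ (X j)) * ∑ i, X (Sum.inr i) * C (A.c i j) *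
      ∏ k ∈ Finset.univ.erase i, rename Sum.inl (A.form k) := by
    apply FaithfulSMul.algebraMap_injective (CoordRing ℓ n) (FractionRing (CoordRing ℓ n))
    rw [map_mul, hs, pairing, Finset.sum_mul, map_sum]
    refine Finset.sum_congr rfl fun j _ ↦ ?_
    rw [map_mul, mul_assoc, omegaCoeff, Finset.sum_mul, map_sum]
    congr 1
    refine Finset.sum_congr rfl fun i _ ↦ ?_
    rw [show q = rename Sum.inl (A.form i) * ∏ k ∈ Finset.univ.erase i, rename Sum.inl (A.form k)
      from (Finset.mul_prod_erase _ _ (Finset.mem_univ i)).symm, map_mul, map_mul, ← mul_assoc,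
      div_mul_cancel₀ _ (A.rename_form_ne_zero i)]
    simp only [map_mul]
  have hq : eval p q = ∏ i, eval x (A.form i) := by
    simp only [q, map_prod, eval_rename_inl]; rfl
  have hq0 : eval p q ≠ 0 := by
    rw [hq]; exact Finset.prod_ne_zero_iff.2 fun i _ ↦ hp' i
  apply mul_right_cancel₀ hq0
  rw [← map_mul, hpoly, map_sum, Finset.sum_mul]
  refine Finset.sum_congr rfl fun j _ ↦ ?_
  rw [map_mul, eval_rename_inl, mul_assoc, map_sum, Finset.sum_mul]
  congr 1
  refine Finset.sum_congr rfl fun i _ ↦ ?_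
  rw [hq, ← Finset.mul_prod_erase _ _ (Finset.mem_univ i), ← mul_assoc,
    div_mul_cancel₀ _ (hp' i)]
  simp only [map_mul, map_prod, eval_rename_inl, eval_X, eval_C]
  rfl

lemma criticalVariety_subset_zeroLocus : A.criticalVariety ⊆ zeroLocus ℂ A.logIdeal := by
  rintro p ⟨hpM, hp⟩
  rw [logIdeal, zeroLocus_span]
  rintro s ⟨θ, -, hs⟩
  rw [aeval_eq_eval, A.eval_of_algebraMap_eq_pairing hs hpM]
  simp [hp]

/-- A derivation multiplying every form `f_i` by `s_i` is logarithmic and pairs to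
`∑ i, a_i * s_i` with the universal form. -/
lemma sum_mem_logIdeal (θ : Derivation ℂ (MvPolynomial (Fin ℓ) ℂ) (MvPolynomial (Fin ℓ) ℂ))
    (s : Fin n → MvPolynomial (Fin ℓ) ℂ) (h : ∀ i, θ (A.form i) = s i * A.form i) :
    ∑ i, X (Sum.inr i) * rename Sum.inl (s i) ∈ A.logIdeal := by
  classical
  refine Ideal.subset_span ⟨θ, ?_, ?_⟩
  · have key : ∀ S : Finset (Fin n),
        θ (∏ i ∈ S, A.form i) = (∑ i ∈ S, s i) * ∏ i ∈ S, A.form i := by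
      intro S
      induction S using Finset.induction_on with
      | empty => simp
      | insert a S ha ih =>
        rw [Finset.prod_insert ha, Finset.sum_insert ha, Derivation.leibniz, ih, h]
        simp only [smul_eq_mul]
        ring
    change θ (∏ i, A.form i) ∈ Ideal.span {∏ i, A.form i}
    rw [key]
    exact Ideal.mul_mem_left _ _ (Ideal.mem_span_singleton_self _)
  · simp only [pairing, omegaCoeff, Finset.mul_sum]
    rw [Finset.sum_comm, map_sum]
    refine Finset.sum_congr rfl fun i _ ↦ ?_
    have h1 := congrArg (rename (Sum.inl : Fin ℓ → Fin ℓ ⊕ Fin n)) (h i)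
    rw [derivation_form, map_sum, map_mul] at h1
    have h2 := congrArg (algebraMap (CoordRing ℓ n) (FractionRing (CoordRing ℓ n))) h1
    rw [map_sum, map_mul] at h2
    have h0 := A.rename_form_ne_zero i
    calc _ = algebraMap (CoordRing ℓ n) (FractionRing (CoordRing ℓ n)) (X (Sum.inr i)) *
          (algebraMap _ _ (rename Sum.inl (s i)) * algebraMap _ _ (rename Sum.inl (A.form i))) /
            algebraMap _ _ (rename Sum.inl (A.form i)) := by
          rw [map_mul]; field_simp
      _ = _ := by
          rw [← h2, Finset.mul_sum, Finset.sum_div]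
          refine Finset.sum_congr rfl fun j _ ↦ ?_
          simp only [map_mul, rename_C]
          ring

/-- The linear conditions which the logarithmic ideal imposes on `lam` over the point `x`. The
derivation with coefficients `g * h j` is used, where `g` is the product of the forms not vanishing
at `x`. -/
lemma sum_eq_zero_of_mem_zeroLocus {p : Fin ℓ ⊕ Fin n → ℂ} (hp : p ∈ zeroLocus ℂ A.logIdeal)
    (h : Fin ℓ → MvPolynomial (Fin ℓ) ℂ) (t : Fin n → ℂ)
    (ht : ∀ i, eval (fun k ↦ p (Sum.inl k)) (A.form i) = 0 →
      ∑ j, C (A.c i j) * h j = C (t i) * A.form i) :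
    ∑ i, p (Sum.inr i) * (if eval (fun k ↦ p (Sum.inl k)) (A.form i) = 0 then t i else
      (∑ j, A.c i j * eval (fun k ↦ p (Sum.inl k)) (h j)) /
        eval (fun k ↦ p (Sum.inl k)) (A.form i)) = 0 := by
  classical
  set x : Fin ℓ → ℂ := fun k ↦ p (Sum.inl k)
  let F : Finset (Fin n) := Finset.univ.filter fun i ↦ eval x (A.form i) ≠ 0
  let g : MvPolynomial (Fin ℓ) ℂ := ∏ i ∈ F, A.form i
  have hg : eval x g ≠ 0 := by
    simp [g, F, map_prod, Finset.prod_ne_zero_iff]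
  have hgi : ∀ i ∈ F, g = A.form i * ∏ k ∈ F.erase i, A.form k := fun i hi ↦
    (Finset.mul_prod_erase _ _ hi).symm
  let s : Fin n → MvPolynomial (Fin ℓ) ℂ := fun i ↦
    if eval x (A.form i) = 0 then g * C (t i) else
      (∏ k ∈ F.erase i, A.form k) * ∑ j, C (A.c i j) * h j
  have hmem := A.sum_mem_logIdeal (mkDerivation ℂ fun j ↦ g * h j) s fun i ↦ by
    rw [derivation_form]
    simp only [mkDerivation_X, mul_left_comm _ g, ← Finset.mul_sum]
    by_cases hi : eval x (A.form i) = 0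
    · simp only [s, hi, if_true, ht i hi]
      ring
    · simp only [s, hi, if_false]
      rw [hgi i (by simp [F, hi])]
      ring
  have h1 := hp _ hmem
  rw [aeval_eq_eval, map_sum] at h1
  apply (mul_eq_zero.1 _).resolve_left hg
  refine Eq.trans ?_ h1
  rw [Finset.mul_sum]
  refine Finset.sum_congr rfl fun i _ ↦ ?_
  rw [map_mul, eval_X, eval_rename_inl, mul_left_comm]
  congr 1
  by_cases hi : eval x (A.form i) = 0
  · simp only [s, hi, if_true, map_mul, eval_C]
    rfl
  · simp only [s, hi, if_false]
    rw [hgi i (by simp [F, hi])]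
    simp only [map_mul, map_sum, eval_C]
    change _ = eval x _ * ∑ j, A.c i j * eval x (h j)
    field_simp

/-! ### The zero set of the logarithmic ideal -/

/-- The restriction to a family of forms: `y ↦ (f_i(y))` for `i` in the family. -/
noncomputable def restrictForms (P : Fin n → Prop) :
    (Fin ℓ → ℂ) →ₗ[ℂ] ({i // P i} → ℂ) :=
  (A.c.submatrix Subtype.val id).mulVecLin

lemma restrictForms_apply (P : Fin n → Prop) (y : Fin ℓ → ℂ) (i : {i // P i}) :
    A.restrictForms P y i = ∑ j, A.c i j * y j := by
  simp [restrictForms, Matrix.mulVec, dotProduct]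

/-- A relation among the coefficient vectors of a family of forms. -/
lemma sum_eq_zero_of_mem_dotPerp {P : Fin n → Prop} [DecidablePred P] {ν : {i // P i} → ℂ}
    (hν : ν ∈ (LinearMap.range (A.restrictForms P)).dotPerp) (j : Fin ℓ) :
    ∑ i : {i // P i}, ν i * A.c i j = 0 := by
  have := hν _ ⟨Pi.single j 1, rfl⟩
  simpa [restrictForms_apply, Pi.single_apply, mul_comm] using this

/-- Sums over a family of hyperplanes as sums over all hyperplanes, extended by zero. -/
lemma sum_subtype_eq {P : Fin n → Prop} [DecidablePred P] (f : {i // P i} → ℂ) :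
    ∑ i, (if h : P i then f ⟨i, h⟩ else 0) = ∑ i : {i // P i}, f i := by
  rw [← Finset.sum_subset (Finset.filter_subset P Finset.univ) fun i _ hi ↦ by
    rw [dif_neg (by simpa using hi)], Finset.sum_subtype _ (p := P) (by simp)]
  exact Finset.sum_congr rfl fun i _ ↦ dif_pos i.2

/-- A linear functional on `ℂ^ℓ` vanishing on the common kernel of a family of forms is a
combination of these forms. -/
lemma exists_eq_sum_of_forall_ker {P : Fin n → Prop} [DecidablePred P] (ω : Fin ℓ → ℂ)
    (h : ∀ v, A.restrictForms P v = 0 → ∑ j, v j * ω j = 0) :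
    ∃ b : {i // P i} → ℂ, ∀ j, ω j = ∑ i : {i // P i}, b i * A.c i j := by
  let W := LinearMap.range (A.c.submatrix (Subtype.val : {i // P i} → Fin n) id).transpose.mulVecLin
  have hW : ω ∈ W.dotPerp.dotPerp := by
    intro v hv
    refine h v (funext fun i ↦ ?_)
    have := hv _ ⟨Pi.single i 1, rfl⟩
    simpa [restrictForms_apply, Matrix.mulVec, dotProduct, Pi.single_apply] using this
  rw [Submodule.dotPerp_dotPerp] at hW
  obtain ⟨b, rfl⟩ := hW
  exact ⟨b, fun j ↦ by simp [Matrix.mulVec, dotProduct, mul_comm]⟩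

variable {A}

/-- Conditions on `lam` along the flat through `x`, from derivations that are constant there. -/
lemma sum_flat_eq_zero {p : Fin ℓ ⊕ Fin n → ℂ} (hp : p ∈ zeroLocus ℂ A.logIdeal)
    (v : Fin ℓ → ℂ)
    (hv : ∀ i, eval (fun k ↦ p (Sum.inl k)) (A.form i) = 0 → ∑ j, A.c i j * v j = 0) :
    ∑ i, p (Sum.inr i) * (if eval (fun k ↦ p (Sum.inl k)) (A.form i) = 0 then 0 else
      (∑ j, A.c i j * v j) / eval (fun k ↦ p (Sum.inl k)) (A.form i)) = 0 := by
  have := A.sum_eq_zero_of_mem_zeroLocus hp (fun j ↦ C (v j)) 0 fun i hi ↦ by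
    simp only [← C_mul, ← map_sum, hv i hi, Pi.zero_apply, map_zero, zero_mul]
  simp only [eval_C, Pi.zero_apply] at this
  exact this

/-- Over a point `x`, the weights of the hyperplanes through `x` are orthogonal to the diagonal
stabilizer of the space of values of the corresponding forms: an element `t` of the stabilizer lifts
to a linear vector field `θ` with `θ(f_i) = t_i f_i` on these forms. -/
lemma mem_dotPerp_diagStabilizer_of_mem_zeroLocus {p : Fin ℓ ⊕ Fin n → ℂ}
    (hp : p ∈ zeroLocus ℂ A.logIdeal) {P : Fin n → Prop} [DecidablePred P]
    (hP : ∀ i, P i ↔ eval (fun k ↦ p (Sum.inl k)) (A.form i) = 0) :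
    (fun i : {i // P i} ↦ p (Sum.inr i)) ∈
      (LinearMap.range (A.restrictForms P)).diagStabilizer.dotPerp := by
  classical
  set x : Fin ℓ → ℂ := fun k ↦ p (Sum.inl k) with hx
  intro t ht
  have hτ : ∀ k, ∃ y, A.restrictForms P y = t * A.restrictForms P (Pi.single k 1) :=
    fun k ↦ ht _ ⟨_, rfl⟩
  -- `τ k` is the value at the `k`-th basis vector of a linear vector field lifting `t`.
  choose τ hτ using hτ
  have hτ' : ∀ k (i : {i // P i}), ∑ j, A.c i j * τ k j = t i * A.c i k := by
    intro k i
    have := congrFun (hτ k) i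
    simpa [restrictForms_apply, Pi.single_apply] using this
  let t' : Fin n → ℂ := fun i ↦ if h : P i then t ⟨i, h⟩ else 0
  let h : Fin ℓ → MvPolynomial (Fin ℓ) ℂ := fun j ↦ ∑ k, C (τ k j) * X k
  have h1 := A.sum_eq_zero_of_mem_zeroLocus hp h t' fun i hi ↦ by
    have hPi := (hP i).2 hi
    simp only [h, form, Finset.mul_sum, t', hPi, dif_pos]
    rw [Finset.sum_comm]
    refine Finset.sum_congr rfl fun k _ ↦ ?_
    simp only [← mul_assoc, ← C_mul, ← Finset.sum_mul, ← map_sum]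
    rw [hτ' k ⟨i, hPi⟩]
  let v : Fin ℓ → ℂ := fun j ↦ eval x (h j)
  -- The linear field is tangent to the flat of `x`, so the hyperplanes off `x` contribute nothing.
  have h2 := sum_flat_eq_zero hp v fun i hi ↦ by
    have hPi := (hP i).2 hi
    simp only [v, h, map_sum, map_mul, eval_C, eval_X, Finset.mul_sum]
    rw [Finset.sum_comm]
    simp only [← mul_assoc, ← Finset.sum_mul, hτ' _ ⟨i, hPi⟩]
    simp only [mul_assoc, ← Finset.mul_sum, ← A.eval_form i x]
    rw [hx, hi, mul_zero]
  have h3 := congrArg₂ (· - ·) h1 h2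
  simp only [← Finset.sum_sub_distrib, sub_zero] at h3
  rw [← h3, ← sum_subtype_eq]
  refine Finset.sum_congr rfl fun i _ ↦ ?_
  by_cases hi : P i
  · have := (hP i).1 hi
    rw [hx] at this
    simp [this, hi, t', mul_comm]
  · have : ¬ eval (fun k ↦ p (Sum.inl k)) (A.form i) = 0 := fun h ↦ hi ((hP i).2 h)
    simp [this, hi, v, hx]

end CentralArrangement

namespace CentralArrangement

variable {ℓ n : ℕ} {A : CentralArrangement ℓ n}

open Topology in
/-- A point of the zero set of the logarithmic ideal whose weights on the hyperplanes through `x`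
have the form `f_i(y) * ν_i`, with `y` off all hyperplanes and `ν` a relation, is approached by
points of the critical variety over `x + ε y`, `ε → 0`. -/
lemma mem_closure_criticalVariety_of_eq_mul {p : Fin ℓ ⊕ Fin n → ℂ}
    {P : Fin n → Prop} [DecidablePred P]
    (hP : ∀ i, P i ↔ eval (fun k ↦ p (Sum.inl k)) (A.form i) = 0)
    (hflat : ∀ v, A.restrictForms P v = 0 →
      ∑ i, p (Sum.inr i) * (if P i then 0 else
        (∑ j, A.c i j * v j) / eval (fun k ↦ p (Sum.inl k)) (A.form i)) = 0)
    {y : Fin ℓ → ℂ} (hy : y ∈ A.complement) {ν : {i // P i} → ℂ}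
    (hν : ν ∈ (LinearMap.range (A.restrictForms P)).dotPerp)
    (hp : ∀ i : {i // P i}, p (Sum.inr i) = A.restrictForms P y i * ν i) :
    p ∈ closure A.criticalVariety := by
  set x : Fin ℓ → ℂ := fun k ↦ p (Sum.inl k) with hx
  -- The part of the universal form away from `x` is a combination of the forms vanishing at `x`.
  obtain ⟨b, hb⟩ := A.exists_eq_sum_of_forall_ker (P := P)
    (fun j ↦ ∑ i, if P i then 0 else p (Sum.inr i) * A.c i j / eval x (A.form i)) fun v hv ↦ by
      refine Eq.trans ?_ (hflat v hv)
      simp only [Finset.mul_sum]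
      rw [Finset.sum_comm]
      refine Finset.sum_congr rfl fun i _ ↦ ?_
      by_cases hi : P i
      · simp [hi]
      · simp only [hi, if_false, Finset.sum_div, Finset.mul_sum]
        exact Finset.sum_congr rfl fun j _ ↦ by ring
  let γ : ℂ → (Fin ℓ ⊕ Fin n → ℂ) := fun ε ↦ Sum.elim (fun j ↦ x j + ε * y j) fun i ↦
    if h : P i then eval y (A.form i) * (ν ⟨i, h⟩ - ε * b ⟨i, h⟩)
    else p (Sum.inr i) * (1 + ε * (eval y (A.form i) / eval x (A.form i)))
  have hγ0 : γ 0 = p := by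
    ext (j | i)
    · simp [γ, hx]
    · by_cases hi : P i
      · simp [γ, hi, hp ⟨i, hi⟩, restrictForms_apply, eval_form]
      · simp [γ, hi]
  have hγc : Continuous γ := by
    refine continuous_pi fun s ↦ ?_
    rcases s with j | i
    · simp only [γ, Sum.elim_inl]; fun_prop
    · by_cases hi : P i
      · simp only [γ, Sum.elim_inr, hi, dif_pos]; fun_prop
      · simp only [γ, Sum.elim_inr, hi, dif_neg, not_false_eq_true]; fun_prop
  have hform : ∀ ε i, eval (fun k ↦ γ ε (Sum.inl k)) (A.form i) =
      eval x (A.form i) + ε * eval y (A.form i) := by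
    intro ε i
    simp only [γ, Sum.elim_inl, eval_form, mul_add, Finset.sum_add_distrib, Finset.mul_sum]
    congr 1
    exact Finset.sum_congr rfl fun j _ ↦ by ring
  have hne : ∀ᶠ ε in 𝓝[≠] (0 : ℂ), ∀ i, eval x (A.form i) + ε * eval y (A.form i) ≠ 0 := by
    rw [Filter.eventually_all]
    intro i
    by_cases hi : P i
    · filter_upwards [self_mem_nhdsWithin] with ε hε
      rw [(hP i).1 hi, zero_add]
      exact mul_ne_zero hε (hy i)
    · have hc : Continuous fun ε : ℂ ↦ eval x (A.form i) + ε * eval y (A.form i) := by fun_prop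
      exact nhdsWithin_le_nhds (hc.continuousAt.eventually_ne
        (by simpa using fun h ↦ hi ((hP i).2 h)))
  have htend : Filter.Tendsto γ (𝓝[≠] 0) (𝓝 p) := by
    rw [← hγ0]
    exact hγc.continuousAt.tendsto.mono_left nhdsWithin_le_nhds
  refine mem_closure_of_tendsto htend ?_
  filter_upwards [hne, self_mem_nhdsWithin] with ε hε hε0
  have hε0 : ε ≠ 0 := hε0
  refine ⟨fun i ↦ by rw [hform]; exact hε i, fun j ↦ ?_⟩
  have hterm : ∀ i, γ ε (Sum.inr i) * A.c i j / eval (fun k ↦ γ ε (Sum.inl k)) (A.form i) =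
      (ε⁻¹ * (if h : P i then ν ⟨i, h⟩ * A.c i j else 0) -
        (if h : P i then b ⟨i, h⟩ * A.c i j else 0)) +
      (if P i then 0 else p (Sum.inr i) * A.c i j / eval x (A.form i)) := by
    intro i
    have h1 := hε i
    rw [hform]
    by_cases hi : P i
    · have h2 := hy i
      have h3 := (hP i).1 hi
      simp only [γ, Sum.elim_inr, hi, dif_pos, if_true, h3]
      field_simp
      ring
    · have h3 : eval x (A.form i) ≠ 0 := fun h ↦ hi ((hP i).2 h)
      simp only [γ, Sum.elim_inr, hi, dif_neg, if_false, not_false_eq_true]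
      field_simp
      ring
  simp only [hterm, Finset.sum_add_distrib, Finset.sum_sub_distrib, ← Finset.mul_sum]
  rw [hb j, sum_subtype_eq (fun i : {i // P i} ↦ ν i * A.c i j),
    sum_subtype_eq (fun i : {i // P i} ↦ b i * A.c i j), A.sum_eq_zero_of_mem_dotPerp hν]
  ring

/-- The zero set of the logarithmic ideal is the closure of the critical variety: over `x`, the
admissible weights of the hyperplanes through `x` are limits of products `f_i(y) * ν_i`. -/
theorem zeroLocus_logIdeal_eq_closure (A : CentralArrangement ℓ n) :
    zeroLocus ℂ A.logIdeal = closure A.criticalVariety := by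
  classical
  refine Set.Subset.antisymm (fun p hp ↦ ?_)
    (closure_minimal A.criticalVariety_subset_zeroLocus (isClosed_zeroLocus _))
  let P : Fin n → Prop := fun i ↦ eval (fun k ↦ p (Sum.inl k)) (A.form i) = 0
  let U := LinearMap.range (A.restrictForms P)
  -- Vary the weights of the hyperplanes through `x` only.
  let Φ : ({i // P i} → ℂ) → (Fin ℓ ⊕ Fin n → ℂ) := fun μ ↦
    Sum.elim (fun j ↦ p (Sum.inl j)) fun i ↦ if h : P i then μ ⟨i, h⟩ else p (Sum.inr i)
  have hΦ : Continuous Φ := by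
    refine continuous_pi fun s ↦ ?_
    rcases s with j | i
    · simp only [Φ, Sum.elim_inl]; fun_prop
    · by_cases hi : P i
      · simp only [Φ, Sum.elim_inr, hi, dif_pos]; fun_prop
      · simp only [Φ, Sum.elim_inr, hi, dif_neg, not_false_eq_true]; fun_prop
  have hflat : ∀ v, A.restrictForms P v = 0 → ∑ i, p (Sum.inr i) * (if P i then 0 else
      (∑ j, A.c i j * v j) / eval (fun k ↦ p (Sum.inl k)) (A.form i)) = 0 := by
    intro v hv
    convert sum_flat_eq_zero hp v fun i hi ↦ ?_
    have := congrFun hv ⟨i, hi⟩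
    rwa [restrictForms_apply] at this
  have hclosed : IsClosed (Φ ⁻¹' closure A.criticalVariety) := isClosed_closure.preimage hΦ
  have hmul : ∀ y ∈ A.complement, ∀ ν ∈ U.dotPerp,
      A.restrictForms P y * ν ∈ Φ ⁻¹' closure A.criticalVariety := by
    intro y hy ν hν
    refine mem_closure_criticalVariety_of_eq_mul (P := P) (fun i ↦ Iff.rfl) ?_ hy hν fun i ↦ ?_
    · intro v hv
      refine Eq.trans ?_ (hflat v hv)
      refine Finset.sum_congr rfl fun i _ ↦ ?_
      by_cases hi : P i
      · simp [hi]
      · simp [Φ, hi]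
    · simp [Φ, i.2]
  -- The points `y` off the hyperplanes are dense, so `y` may be arbitrary.
  have hmul' : {μ | ∃ u ∈ U, ∃ w ∈ U.dotPerp, u * w = μ} ⊆ Φ ⁻¹' closure A.criticalVariety := by
    rintro _ ⟨_, ⟨y, rfl⟩, ν, hν, rfl⟩
    have hc : Continuous fun y ↦ A.restrictForms P y * ν :=
      (LinearMap.continuous_of_finiteDimensional _).mul continuous_const
    exact closure_minimal (fun y hy ↦ hmul y hy ν hν) (hclosed.preimage hc)
      (A.dense_complement y)
  have hmem := closure_minimal hmul' hclosed (U.dotPerp_diagStabilizer_subset_closure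
    (mem_dotPerp_diagStabilizer_of_mem_zeroLocus hp fun i ↦ Iff.rfl))
  have hΦp : Φ (fun i ↦ p (Sum.inr i)) = p := by
    ext (j | i) <;> simp [Φ]
  rwa [Set.mem_preimage, hΦp] at hmem

end CentralArrangement

/-! ### Graphs of rational maps and their codimension -/

namespace RationalGraph

variable {σ κ : Type*} (τ : κ → σ) (q : MvPolynomial σ ℂ) (r : κ → MvPolynomial σ ℂ)

/-- The polynomial `f` does not depend on the variables `τ k`, `k ∈ T`. -/
def IsIndependentOf (T : Finset κ) (f : MvPolynomial σ ℂ) : Prop :=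
  ∀ x y : σ → ℂ, (∀ s, (∀ k ∈ T, s ≠ τ k) → x s = y s) → eval x f = eval y f

/-- The graph `p (τ k) = r k / q`, `k ∈ T`, over the complement of the hypersurface `q = 0`. -/
def graph (T : Finset κ) : Set (σ → ℂ) :=
  {p | eval p q ≠ 0 ∧ ∀ k ∈ T, eval p q * p (τ k) = eval p (r k)}

/-- The ideal generated by the equations of the graph. -/
noncomputable def graphIdeal (T : Finset κ) : Ideal (MvPolynomial σ ℂ) :=
  Ideal.span ((fun k ↦ q * X (τ k) - r k) '' T)

variable {τ q r} {T : Finset κ}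

lemma IsIndependentOf.mono {T' : Finset κ} {f : MvPolynomial σ ℂ} (h : IsIndependentOf τ T f)
    (hT : T' ⊆ T) : IsIndependentOf τ T' f :=
  fun x y hxy ↦ h x y fun s hs ↦ hxy s fun k hk ↦ hs k (hT hk)

lemma graphIdeal_le_vanishingIdeal : graphIdeal τ q r T ≤ vanishingIdeal ℂ (graph τ q r T) := by
  refine Ideal.span_le.2 ?_
  rintro _ ⟨k, hk, rfl⟩ p hp
  simp [aeval_eq_eval, hp.2 k hk]

/-- Modulo the equations of the graph and up to a power of `q`, every polynomial is independent of
the variables `τ k`. -/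
lemma exists_pow_mul_sub_mem (hq : IsIndependentOf τ T q)
    (hr : ∀ k ∈ T, IsIndependentOf τ T (r k)) (f : MvPolynomial σ ℂ) :
    ∃ (N : ℕ) (h : MvPolynomial σ ℂ),
      IsIndependentOf τ T h ∧ q ^ N * f - h ∈ graphIdeal τ q r T := by
  classical
  induction f using MvPolynomial.induction_on with
  | C a => exact ⟨0, C a, fun x y _ ↦ by simp, by simp⟩
  | add f g hf hg =>
    obtain ⟨N, h, hh, hN⟩ := hf
    obtain ⟨M, k, hk, hM⟩ := hg
    refine ⟨N + M, q ^ M * h + q ^ N * k, fun x y hxy ↦ by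
      simp [hq x y hxy, hh x y hxy, hk x y hxy], ?_⟩
    convert add_mem (Ideal.mul_mem_left _ (q ^ M) hN) (Ideal.mul_mem_left _ (q ^ N) hM) using 1
    ring
  | mul_X f s hf =>
    obtain ⟨N, h, hh, hN⟩ := hf
    by_cases hs : ∃ k ∈ T, s = τ k
    · obtain ⟨k, hk, rfl⟩ := hs
      refine ⟨N + 1, h * r k, fun x y hxy ↦ by simp [hh x y hxy, hr k hk x y hxy], ?_⟩
      convert add_mem (Ideal.mul_mem_left _ (q * X (τ k)) hN) (Ideal.mul_mem_left _ h
        (Ideal.subset_span ⟨k, hk, rfl⟩ : q * X (τ k) - r k ∈ graphIdeal τ q r T)) using 1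
      ring
    · push Not at hs
      refine ⟨N, h * X s, fun x y hxy ↦ by simp [hh x y hxy, hxy s hs], ?_⟩
      convert Ideal.mul_mem_right (X s) _ hN using 1
      ring

/-- Every point with `q ≠ 0` can be moved into the graph by changing the coordinates `τ k`. -/
lemma exists_mem_graph (hτ : Function.Injective τ) (hq : IsIndependentOf τ T q)
    (hr : ∀ k ∈ T, IsIndependentOf τ T (r k)) {x : σ → ℂ} (hx : eval x q ≠ 0) :
    ∃ p ∈ graph τ q r T, ∀ s, (∀ k ∈ T, s ≠ τ k) → p s = x s := by
  classical
  let p : σ → ℂ := fun s ↦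
    if h : ∃ k ∈ T, s = τ k then eval x (r h.choose) / eval x q else x s
  have hp : ∀ s, (∀ k ∈ T, s ≠ τ k) → p s = x s := fun s hs ↦ by
    simp only [p]
    rw [dif_neg (by push Not; exact hs)]
  refine ⟨p, ⟨by rwa [hq p x hp], fun k hk ↦ ?_⟩, hp⟩
  have h : ∃ k' ∈ T, τ k = τ k' := ⟨k, hk, rfl⟩
  rw [hq p x hp, hr k hk p x hp]
  simp only [p]
  rw [dif_pos h, ← hτ h.choose_spec.2]
  field_simp

/-- The remaining variables are algebraically independent on the graph. -/
lemma eq_zero_of_mem_vanishingIdeal (hτ : Function.Injective τ) (hq0 : q ≠ 0)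
    (hq : IsIndependentOf τ T q) (hr : ∀ k ∈ T, IsIndependentOf τ T (r k))
    {h : MvPolynomial σ ℂ} (hh : IsIndependentOf τ T h)
    (hmem : h ∈ vanishingIdeal ℂ (graph τ q r T)) : h = 0 := by
  have : q * h = 0 := MvPolynomial.funext fun x ↦ by
    by_cases hx : eval x q = 0
    · simp [hx]
    · obtain ⟨p, hp, hpx⟩ := exists_mem_graph hτ hq hr hx
      have := hmem p hp
      rw [aeval_eq_eval, hh p x hpx] at this
      simp [this]
  exact (mul_eq_zero.1 this).resolve_left hq0

lemma mem_vanishingIdeal_of_pow_mul_mem {N : ℕ} {f : MvPolynomial σ ℂ}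
    (h : q ^ N * f ∈ vanishingIdeal ℂ (graph τ q r T)) : f ∈ vanishingIdeal ℂ (graph τ q r T) := by
  intro p hp
  have := h p hp
  simp only [aeval_eq_eval, map_mul, map_pow] at this ⊢
  exact (mul_eq_zero.1 this).resolve_left (pow_ne_zero _ hp.1)

lemma notMem_vanishingIdeal (hτ : Function.Injective τ) (hq0 : q ≠ 0)
    (hq : IsIndependentOf τ T q) (hr : ∀ k ∈ T, IsIndependentOf τ T (r k)) :
    q ∉ vanishingIdeal ℂ (graph τ q r T) :=
  fun h ↦ hq0 (eq_zero_of_mem_vanishingIdeal hτ hq0 hq hr hq h)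

/-- The graph is parametrized by the remaining variables, so its vanishing ideal is prime. -/
theorem isPrime_vanishingIdeal_graph (hτ : Function.Injective τ) (hq0 : q ≠ 0)
    (hq : IsIndependentOf τ T q) (hr : ∀ k ∈ T, IsIndependentOf τ T (r k)) :
    (vanishingIdeal ℂ (graph τ q r T)).IsPrime := by
  refine ⟨fun htop ↦ notMem_vanishingIdeal hτ hq0 hq hr (htop ▸ Submodule.mem_top), ?_⟩
  intro f g hfg
  obtain ⟨N, h, hh, hN⟩ := exists_pow_mul_sub_mem hq hr f
  obtain ⟨M, k, hk, hM⟩ := exists_pow_mul_sub_mem hq hr g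
  have hN' := graphIdeal_le_vanishingIdeal hN
  have hM' := graphIdeal_le_vanishingIdeal hM
  have hhk : h * k ∈ vanishingIdeal ℂ (graph τ q r T) := by
    convert sub_mem (sub_mem (Ideal.mul_mem_left _ (q ^ N * q ^ M) hfg)
      (Ideal.mul_mem_left _ (q ^ M * g) hN')) (Ideal.mul_mem_left _ h hM') using 1
    ring
  have h0 := eq_zero_of_mem_vanishingIdeal hτ hq0 hq hr
    (fun x y hxy ↦ by simp [hh x y hxy, hk x y hxy]) hhk
  rcases mul_eq_zero.1 h0 with rfl | rfl
  · exact Or.inl (mem_vanishingIdeal_of_pow_mul_mem (by simpa using hN'))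
  · exact Or.inr (mem_vanishingIdeal_of_pow_mul_mem (by simpa using hM'))

/-- By Krull's height theorem, since the vanishing ideal is minimal over the equations. -/
lemma height_vanishingIdeal_graph_le [Finite σ] (hτ : Function.Injective τ) (hq0 : q ≠ 0)
    (hq : IsIndependentOf τ T q) (hr : ∀ k ∈ T, IsIndependentOf τ T (r k)) :
    (vanishingIdeal ℂ (graph τ q r T)).height ≤ T.card := by
  classical
  have hmin : vanishingIdeal ℂ (graph τ q r T) ∈ (Ideal.span
      ((T.image fun k ↦ q * X (τ k) - r k : Finset _) : Set (MvPolynomial σ ℂ))).minimalPrimes := by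
    rw [Finset.coe_image]
    refine ⟨⟨isPrime_vanishingIdeal_graph hτ hq0 hq hr, graphIdeal_le_vanishingIdeal⟩, ?_⟩
    rintro p ⟨hp, hle⟩ hpP f hf
    obtain ⟨N, h, hh, hN⟩ := exists_pow_mul_sub_mem hq hr f
    have hhP : h ∈ vanishingIdeal ℂ (graph τ q r T) := by
      convert sub_mem (Ideal.mul_mem_left _ (q ^ N) hf) (graphIdeal_le_vanishingIdeal hN) using 1
      ring
    obtain rfl := eq_zero_of_mem_vanishingIdeal hτ hq0 hq hr hh hhP
    rw [sub_zero] at hN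
    exact (hp.mem_or_mem (hle hN)).resolve_left fun hqN ↦
      notMem_vanishingIdeal hτ hq0 hq hr (hpP (hp.mem_of_pow_mem N hqN))
  exact (Ideal.height_le_card_of_mem_minimalPrimes_span_finset hmin).trans
    (by exact_mod_cast Finset.card_image_le)

/-- Imposing the equations one at a time gives a chain of primes. -/
lemma card_le_height_vanishingIdeal_graph (hτ : Function.Injective τ) (hq0 : q ≠ 0)
    (hq : IsIndependentOf τ T q) (hr : ∀ k ∈ T, IsIndependentOf τ T (r k)) :
    T.card ≤ (vanishingIdeal ℂ (graph τ q r T)).height := by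
  classical
  induction T using Finset.induction_on with
  | empty => simp
  | insert b T hb ih =>
    have hsub : T ⊆ insert b T := Finset.subset_insert b T
    have hq' := hq.mono hsub
    have hr' : ∀ k ∈ T, IsIndependentOf τ T (r k) := fun k hk ↦ (hr k (hsub hk)).mono hsub
    have := isPrime_vanishingIdeal_graph hτ hq0 hq' hr'
    have := isPrime_vanishingIdeal_graph hτ hq0 hq hr
    have hlt : vanishingIdeal ℂ (graph τ q r T) < vanishingIdeal ℂ (graph τ q r (insert b T)) := by
      refine SetLike.lt_iff_le_and_exists.2 ⟨vanishingIdeal_anti_mono fun p hp ↦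
        ⟨hp.1, fun k hk ↦ hp.2 k (hsub hk)⟩, q * X (τ b) - r b,
        graphIdeal_le_vanishingIdeal (Ideal.subset_span ⟨b, by simp, rfl⟩), fun hmem ↦ ?_⟩
      obtain ⟨x, hx⟩ : ∃ x, eval x q ≠ 0 := by
        by_contra! hcon
        exact hq0 (MvPolynomial.funext fun x ↦ by simp [hcon x])
      obtain ⟨p, hp, -⟩ := exists_mem_graph hτ hq' hr' hx
      -- Moving the coordinate `τ b` alone leaves the graph over `T` and breaks the new equation.
      let p' := Function.update p (τ b) ((eval p (r b) + 1) / eval p q)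
      have hpp' : ∀ s, (∀ k ∈ insert b T, s ≠ τ k) → p' s = p s := fun s hs ↦
        Function.update_of_ne (hs b (by simp)) _ _
      have hq'' := hq p' p hpp'
      have hp' : p' ∈ graph τ q r T := by
        refine ⟨by rw [hq'']; exact hp.1, fun k hk ↦ ?_⟩
        have hkb : τ k ≠ τ b := fun h ↦ hb (hτ h ▸ hk)
        rw [hq'', hr k (hsub hk) p' p hpp', ← hp.2 k hk]
        simp [p', hkb]
      have h0 := hmem p' hp'
      rw [aeval_eq_eval, map_sub, map_mul, eval_X, hq'', hr b (by simp) p' p hpp'] at h0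
      simp [p', mul_div_cancel₀ _ hp.1] at h0
    calc ((insert b T).card : ℕ∞) = T.card + 1 := by
          rw [Finset.card_insert_of_notMem hb]; norm_cast
      _ ≤ (vanishingIdeal ℂ (graph τ q r T)).height + 1 := by gcongr; exact ih hq' hr'
      _ ≤ _ := Ideal.height_add_one_le_of_lt_of_isPrime hlt

end RationalGraph

/-! ### The critical variety of an arrangement of full rank -/

lemma isIrreducibleVariety_of_isPrime {σ : Type} {Z : Set (σ → ℂ)}
    (hZ : ∃ J : Ideal (MvPolynomial σ ℂ), Z = zeroLocus ℂ J) (hp : (vanishingIdeal ℂ Z).IsPrime) :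
    IsIrreducibleVariety Z := by
  refine ⟨hZ, ?_, fun J K hJK ↦ ?_⟩
  · rw [Set.nonempty_iff_ne_empty]
    rintro rfl
    exact hp.ne_top vanishingIdeal_empty
  · simp only [le_zeroLocus_iff_le_vanishingIdeal]
    by_contra! hcon
    obtain ⟨f, hfJ, hf⟩ := SetLike.not_le_iff_exists.1 hcon.1
    obtain ⟨g, hgK, hg⟩ := SetLike.not_le_iff_exists.1 hcon.2
    refine (hp.mem_or_mem (x := f) (y := g) fun p hpZ ↦ ?_).elim hf hg
    rcases hJK hpZ with h | h
    · rw [map_mul, h f hfJ, zero_mul]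
    · rw [map_mul, h g hgK, mul_zero]

namespace CentralArrangement

open RationalGraph

variable {ℓ n : ℕ} (A : CentralArrangement ℓ n)

/-- For an arrangement of rank `ℓ`, the equations of the critical variety can be solved for the
weights of `ℓ` linearly independent hyperplanes. -/
lemma exists_criticalVariety_eq_graph (hA : A.rank = ℓ) :
    ∃ (κ : Type) (_ : Fintype κ) (τ : κ → Fin ℓ ⊕ Fin n) (r : κ → CoordRing ℓ n),
      Fintype.card κ = ℓ ∧ Function.Injective τ ∧
      IsIndependentOf τ Finset.univ (rename Sum.inl A.definingPoly) ∧
      (∀ k, IsIndependentOf τ Finset.univ (r k)) ∧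
      A.criticalVariety = graph τ (rename Sum.inl A.definingPoly) r Finset.univ := by
  classical
  obtain ⟨κ, a, ha, hspan, hli⟩ := exists_linearIndependent' ℂ A.c
  have : Finite κ := Finite.of_injective a ha
  have := Fintype.ofFinite κ
  have hcard : Fintype.card κ = ℓ := by
    rw [← finrank_span_eq_card hli, hspan]
    exact (Matrix.rank_eq_finrank_span_row A.c).symm.trans hA
  have htop : Submodule.span ℂ (Set.range (A.c ∘ a)) = ⊤ := by
    apply Submodule.eq_top_of_finrank_eq
    rw [finrank_span_eq_card hli, hcard]
    simp
  let B := Module.Basis.mk hli htop.ge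
  have hB : ∀ k, B k = A.c (a k) := Module.Basis.mk_apply hli htop.ge
  let S : Finset (Fin n) := Finset.univ.image a
  let r : κ → CoordRing ℓ n := fun k ↦ -(rename Sum.inl (A.form (a k)) * ∑ i ∈ Sᶜ,
    C (B.repr (A.c i) k) * X (Sum.inr i) * rename Sum.inl (∏ i' ∈ Finset.univ.erase i, A.form i'))
  have hind : ∀ f : MvPolynomial (Fin ℓ) ℂ,
      IsIndependentOf (fun k ↦ Sum.inr (a k)) Finset.univ
        (rename (Sum.inl : Fin ℓ → Fin ℓ ⊕ Fin n) f) := by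
    intro f x y hxy
    rw [eval_rename_inl, eval_rename_inl]
    congr 2
    ext j
    exact hxy _ (by simp)
  refine ⟨κ, inferInstance, fun k ↦ Sum.inr (a k), r, hcard, Sum.inr_injective.comp ha,
    hind _, fun k x y hxy ↦ ?_, ?_⟩
  · simp only [r, map_neg, map_mul, map_sum (eval _), eval_C, eval_X, hind _ x y hxy]
    congr 2
    refine Finset.sum_congr rfl fun i hi ↦ ?_
    rw [hxy (Sum.inr i) fun k _ h ↦ ?_]
    simp only [S, Finset.mem_compl, Finset.mem_image, Finset.mem_univ, true_and, not_exists] at hi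
    exact hi k (Sum.inr_injective h).symm
  · ext p
    set x : Fin ℓ → ℂ := fun k ↦ p (Sum.inl k) with hx
    have hQ : eval p (rename Sum.inl A.definingPoly) ≠ 0 ↔ x ∈ A.complement := by
      rw [eval_rename_inl, eval_definingPoly_ne_zero_iff]
    refine Iff.trans (and_congr_right fun hxM ↦ ?_) (and_congr_left' hQ.symm)
    have hform : ∀ i, eval x (A.form i) ≠ 0 := hxM
    -- Compare coordinates in the basis `B` instead of the standard basis.
    let w : Fin ℓ → ℂ := ∑ i, (p (Sum.inr i) / eval x (A.form i)) • A.c i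
    have hw : (∀ j, ∑ i, p (Sum.inr i) * A.c i j / eval x (A.form i) = 0) ↔
        ∀ k, B.repr w k = 0 := by
      have h0 : (∀ k, B.repr w k = 0) ↔ w = 0 := by
        rw [← B.repr.map_eq_zero_iff, Finsupp.ext_iff]; rfl
      rw [h0, funext_iff]
      refine forall_congr' fun j ↦ ?_
      simp [w, Finset.sum_apply, div_mul_eq_mul_div]
    rw [hw]
    simp only [Finset.mem_univ, true_imp_iff]
    refine forall_congr' fun k ↦ ?_
    have hrepr : B.repr w k = p (Sum.inr (a k)) / eval x (A.form (a k)) +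
        ∑ i ∈ Sᶜ, p (Sum.inr i) / eval x (A.form i) * B.repr (A.c i) k := by
      simp only [w, map_sum, map_smul, Finsupp.coe_finsetSum, Finset.sum_apply, Finsupp.smul_apply,
        smul_eq_mul]
      rw [← Finset.sum_add_sum_compl S, Finset.sum_image ha.injOn]
      congr 1
      simp [← hB, Finsupp.single_apply]
    have hr : eval p (r k) = -(eval x (A.form (a k)) * ∑ i ∈ Sᶜ, eval x A.definingPoly *
        (p (Sum.inr i) / eval x (A.form i) * B.repr (A.c i) k)) := by
      simp only [r, map_neg, map_mul, map_sum (eval _), eval_C, eval_X, eval_rename_inl]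
      congr 2
      refine Finset.sum_congr rfl fun i _ ↦ ?_
      rw [definingPoly, ← Finset.mul_prod_erase _ _ (Finset.mem_univ i), map_mul]
      have := hform i
      change _ * eval x _ = _
      field_simp
    rw [hr, hrepr, eval_rename_inl, ← Finset.mul_sum]
    have h1 := hform (a k)
    have h2 := A.eval_definingPoly_ne_zero_iff.2 hxM
    change _ ↔ eval x A.definingPoly * _ = _
    have h3 : eval x A.definingPoly * p (Sum.inr (a k)) - -(eval x (A.form (a k)) *
        (eval x A.definingPoly * ∑ i ∈ Sᶜ, p (Sum.inr i) / eval x (A.form i) * B.repr (A.c i) k)) =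
        eval x A.definingPoly * eval x (A.form (a k)) * (p (Sum.inr (a k)) / eval x (A.form (a k)) +
        ∑ i ∈ Sᶜ, p (Sum.inr i) / eval x (A.form i) * B.repr (A.c i) k) := by
      field_simp
      ring
    rw [← sub_eq_zero (a := eval x A.definingPoly * _), h3, mul_eq_zero,
      or_iff_right (mul_ne_zero h2 h1)]

end CentralArrangement

theorem mainTheorem4 (ℓ n : ℕ) (A : CentralArrangement ℓ n) :
    zeroLocus ℂ A.logIdeal = closure A.criticalVariety ∧
      (A.rank = ℓ →
        IsIrreducibleVariety (closure A.criticalVariety) ∧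
          varietyCodim (closure A.criticalVariety) = (ℓ : ℕ∞)) := by
  refine ⟨A.zeroLocus_logIdeal_eq_closure, fun hA ↦ ?_⟩
  obtain ⟨κ, _, τ, r, hcard, hτ, hq, hr, hgraph⟩ := A.exists_criticalVariety_eq_graph hA
  have hq0 : (rename Sum.inl A.definingPoly : CentralArrangement.CoordRing ℓ n) ≠ 0 := fun h ↦
    A.definingPoly_ne_zero (rename_injective _ Sum.inl_injective (by rw [h, map_zero]))
  have hr' : ∀ k ∈ Finset.univ, RationalGraph.IsIndependentOf τ Finset.univ (r k) := fun k _ ↦ hr k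
  constructor
  · refine isIrreducibleVariety_of_isPrime ⟨_, A.zeroLocus_logIdeal_eq_closure.symm⟩ ?_
    rw [vanishingIdeal_closure, hgraph]
    exact RationalGraph.isPrime_vanishingIdeal_graph hτ hq0 hq hr'
  · rw [varietyCodim, vanishingIdeal_closure, hgraph]
    have hc : ((Finset.univ : Finset κ).card : ℕ∞) = ℓ := by rw [Finset.card_univ, hcard]
    exact le_antisymm
      ((RationalGraph.height_vanishingIdeal_graph_le hτ hq0 hq hr').trans hc.le)
      (hc.ge.trans (RationalGraph.card_le_height_vanishingIdeal_graph hτ hq0 hq hr'))
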